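/- Assume the Continuum Hypothesis ($2^{\aleph_0}=\aleph_1$). Let $H$ be a separable complex Hilbert space and let $\mathcal N$ be a nest on $H$, i.e. a set of orthogonal projections on $H$ that is linearly ordered, contains $0$ and $I$, and is closed in the weak operator topology. Let $T(\mathcal N)$ be its nest algebra, the algebra of bounded operators on $H$ that leave invariant the range of every projection in $\mathcal N$. For $X\in T(\mathcal N)$ and $N\in\mathcal N$ put $$ i_N^+(X)=\inf\{\|(M-N)X(M-N)\| : M\in\mathcal N,\ M>N\}\quad (N<I),$$ $$ i_N^-(X)=\inf\{\|(N-M)X(N-M)\| : M\in\mathcal N,\ M<N\}\quad (N>0).$$ The diagonal ideals of $T(\mathcal N)$ are the two-sided ideals $\mathcal I_N^+=\{X\in T(\mathcal N): i_N^+(X)=0\}$ for $N\in\mathcal N$, $N<I$, and $\mathcal I_N^-=\{X\in T(\mathcal N): i_N^-(X)=0\}$ for $N\in\mathcal N$, $N>0$. Then every diagonal ideal of $T(\mathcal N)$ is a right-primitive ideal, that is, it is the annihilator of a simple right $T(\mathcal N)$-module. -/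

import Mathlib

open Cardinal

/-- A nest on a complex Hilbert space `H`: a set of orthogonal projections which is linearly
ordered (for the usual order of operators), contains `0` and `I`, and is closed in the weak
operator topology. -/
structure Nest (H : Type*) [NormedAddCommGroup H] [InnerProductSpace ℂ H] [CompleteSpace H] where
  /-- The projections of the nest. -/
  carrier : Set (H →L[ℂ] H)
  isStarProjection : ∀ P ∈ carrier, IsStarProjection P
  total : ∀ P ∈ carrier, ∀ Q ∈ carrier, P ≤ Q ∨ Q ≤ P
  zero_mem : (0 : H →L[ℂ] H) ∈ carrier
  one_mem : (1 : H →L[ℂ] H) ∈ carrier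
  weakly_closed : IsClosed {A : H →WOT[ℂ] H | A.toCLM ∈ carrier}

namespace Nest

section

variable {H : Type*} [NormedAddCommGroup H] [InnerProductSpace ℂ H] [CompleteSpace H]

/-- The nest algebra: the bounded operators leaving invariant the ranges of the projections of
the nest. -/
def algebra (𝒩 : Nest H) : Subalgebra ℂ (H →L[ℂ] H) where
  carrier := {X | ∀ P ∈ 𝒩.carrier, Set.MapsTo X (Set.range P) (Set.range P)}
  mul_mem' := fun hX hY P hP => (hX P hP).comp (hY P hP)
  add_mem' := by
    rintro X Y hX hY P hP _ ⟨x, rfl⟩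
    obtain ⟨a, ha⟩ := hX P hP ⟨x, rfl⟩
    obtain ⟨b, hb⟩ := hY P hP ⟨x, rfl⟩
    exact ⟨a + b, by simp [ha, hb]⟩
  algebraMap_mem' := by
    rintro c P hP _ ⟨x, rfl⟩
    exact ⟨c • x, by simp [Algebra.algebraMap_eq_smul_one]⟩

/-- The diagonal seminorm function `i⁺_N(X) = inf {‖(M - N) X (M - N)‖ : M > N in the nest}`,
to be used for `N < I`. -/
noncomputable def iPlus (𝒩 : Nest H) (N X : H →L[ℂ] H) : ℝ :=
  ⨅ M : {M : H →L[ℂ] H // M ∈ 𝒩.carrier ∧ N < M}, ‖(M.1 - N) * X * (M.1 - N)‖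

/-- The diagonal seminorm function `i⁻_N(X) = inf {‖(N - M) X (N - M)‖ : M < N in the nest}`,
to be used for `N > 0`. -/
noncomputable def iMinus (𝒩 : Nest H) (N X : H →L[ℂ] H) : ℝ :=
  ⨅ M : {M : H →L[ℂ] H // M ∈ 𝒩.carrier ∧ M < N}, ‖(N - M.1) * X * (N - M.1)‖

/-! Facts showing that the kernels of the diagonal seminorm functions are two-sided ideals. -/

theorem mul_of_le (𝒩 : Nest H) {P Q : H →L[ℂ] H} (hP : P ∈ 𝒩.carrier) (hQ : Q ∈ 𝒩.carrier)
    (h : P ≤ Q) : P * Q = P ∧ Q * P = P :=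
  ⟨((𝒩.isStarProjection P hP).le_iff_mul_eq_left (𝒩.isStarProjection Q hQ)).1 h,
    ((𝒩.isStarProjection P hP).le_iff_mul_eq_right (𝒩.isStarProjection Q hQ)).1 h⟩

theorem mul_mul_of_mem (𝒩 : Nest H) {X P : H →L[ℂ] H} (hX : X ∈ 𝒩.algebra)
    (hP : P ∈ 𝒩.carrier) : P * X * P = X * P := by
  ext x
  obtain ⟨y, hy⟩ := hX P hP ⟨x, rfl⟩
  have h2 := congrArg (fun T : H →L[ℂ] H => T y) (𝒩.isStarProjection P hP).isIdempotentElem.eq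
  simp only [mul_apply_eq_comp] at h2 ⊢
  rw [← hy, h2]

theorem norm_sub_le_one (𝒩 : Nest H) {P Q : H →L[ℂ] H} (hP : P ∈ 𝒩.carrier)
    (hQ : Q ∈ 𝒩.carrier) (h : P ≤ Q) : ‖Q - P‖ ≤ 1 :=
  (((𝒩.isStarProjection P hP).le_iff_sub (𝒩.isStarProjection Q hQ)).1 h).norm_le

theorem compress_mul (𝒩 : Nest H) {P Q X Y : H →L[ℂ] H} (hP : P ∈ 𝒩.carrier)
    (hQ : Q ∈ 𝒩.carrier) (h : P ≤ Q) (hX : X ∈ 𝒩.algebra) (hY : Y ∈ 𝒩.algebra) :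
    (Q - P) * (X * Y) * (Q - P) = ((Q - P) * X * (Q - P)) * ((Q - P) * Y * (Q - P)) := by
  obtain ⟨h1, h2⟩ := 𝒩.mul_of_le hP hQ h
  have hPP : P * P = P := (𝒩.isStarProjection P hP).isIdempotentElem.eq
  have hQQ : Q * Q = Q := (𝒩.isStarProjection Q hQ).isIdempotentElem.eq
  have hEE : (Q - P) * (Q - P) = Q - P := by
    rw [mul_sub, sub_mul, sub_mul, hQQ, h1, h2, hPP]; abel
  have hQE : Q * (Q - P) = Q - P := by rw [mul_sub, hQQ, h2]
  have hEP : (Q - P) * P = 0 := by rw [sub_mul, h2, hPP, sub_self]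
  have hYE : Y * (Q - P) = Q * (Y * (Q - P)) := by
    calc Y * (Q - P) = (Y * Q) * (Q - P) := by rw [mul_assoc, hQE]
      _ = (Q * Y * Q) * (Q - P) := by rw [𝒩.mul_mul_of_mem hY hQ]
      _ = Q * (Y * (Q - P)) := by rw [mul_assoc, mul_assoc, hQE]
  have hEXP : (Q - P) * X * P = 0 := by
    calc (Q - P) * X * P = (Q - P) * (P * X * P) := by rw [𝒩.mul_mul_of_mem hX hP, mul_assoc]
      _ = ((Q - P) * P) * (X * P) := by simp only [mul_assoc]
      _ = 0 := by rw [hEP, zero_mul]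
  calc (Q - P) * (X * Y) * (Q - P) = (Q - P) * X * (Y * (Q - P)) := by simp only [mul_assoc]
    _ = (Q - P) * X * (Q * (Y * (Q - P))) := by rw [← hYE]
    _ = (Q - P) * X * ((Q - P) * (Y * (Q - P))) + ((Q - P) * X * P) * (Y * (Q - P)) := by
        simp only [sub_mul, mul_sub, mul_assoc]; abel
    _ = (Q - P) * X * (((Q - P) * (Q - P)) * (Y * (Q - P))) := by
        rw [hEXP, zero_mul, add_zero, hEE]
    _ = _ := by simp only [mul_assoc]

theorem norm_compress_mul_le_left (𝒩 : Nest H) {P Q X Y : H →L[ℂ] H} (hP : P ∈ 𝒩.carrier)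
    (hQ : Q ∈ 𝒩.carrier) (h : P ≤ Q) (hX : X ∈ 𝒩.algebra) (hY : Y ∈ 𝒩.algebra) :
    ‖(Q - P) * (X * Y) * (Q - P)‖ ≤ ‖X‖ * ‖(Q - P) * Y * (Q - P)‖ := by
  rw [𝒩.compress_mul hP hQ h hX hY]
  refine (norm_mul_le _ _).trans (mul_le_mul_of_nonneg_right ?_ (norm_nonneg _))
  have h1 := 𝒩.norm_sub_le_one hP hQ h
  calc ‖(Q - P) * X * (Q - P)‖ ≤ ‖Q - P‖ * ‖X‖ * ‖Q - P‖ :=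
        (norm_mul_le _ _).trans (mul_le_mul_of_nonneg_right (norm_mul_le _ _) (norm_nonneg _))
    _ ≤ 1 * ‖X‖ * 1 := by gcongr
    _ = ‖X‖ := by ring

theorem norm_compress_mul_le_right (𝒩 : Nest H) {P Q X Y : H →L[ℂ] H} (hP : P ∈ 𝒩.carrier)
    (hQ : Q ∈ 𝒩.carrier) (h : P ≤ Q) (hX : X ∈ 𝒩.algebra) (hY : Y ∈ 𝒩.algebra) :
    ‖(Q - P) * (X * Y) * (Q - P)‖ ≤ ‖(Q - P) * X * (Q - P)‖ * ‖Y‖ := by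
  rw [𝒩.compress_mul hP hQ h hX hY]
  refine (norm_mul_le _ _).trans (mul_le_mul_of_nonneg_left ?_ (norm_nonneg _))
  have h1 := 𝒩.norm_sub_le_one hP hQ h
  calc ‖(Q - P) * Y * (Q - P)‖ ≤ ‖Q - P‖ * ‖Y‖ * ‖Q - P‖ :=
        (norm_mul_le _ _).trans (mul_le_mul_of_nonneg_right (norm_mul_le _ _) (norm_nonneg _))
    _ ≤ 1 * ‖Y‖ * 1 := by gcongr
    _ = ‖Y‖ := by ring

theorem norm_compress_le (𝒩 : Nest H) {P P' Q Q' : H →L[ℂ] H} (hP : P ∈ 𝒩.carrier)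
    (hP' : P' ∈ 𝒩.carrier) (hQ : Q ∈ 𝒩.carrier) (hQ' : Q' ∈ 𝒩.carrier)
    (h1 : P ≤ P') (h2 : P' ≤ Q') (h3 : Q' ≤ Q) (X : H →L[ℂ] H) :
    ‖(Q' - P') * X * (Q' - P')‖ ≤ ‖(Q - P) * X * (Q - P)‖ := by
  have e1 : (Q' - P') * (Q - P) = Q' - P' := by
    rw [mul_sub, sub_mul, sub_mul, (𝒩.mul_of_le hQ' hQ h3).1,
      (𝒩.mul_of_le hP' hQ (h2.trans h3)).1, (𝒩.mul_of_le hP hQ' (h1.trans h2)).2,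
      (𝒩.mul_of_le hP hP' h1).2]
    abel
  have e2 : (Q - P) * (Q' - P') = Q' - P' := by
    rw [mul_sub, sub_mul, sub_mul, (𝒩.mul_of_le hQ' hQ h3).2,
      (𝒩.mul_of_le hP' hQ (h2.trans h3)).2, (𝒩.mul_of_le hP hQ' (h1.trans h2)).1,
      (𝒩.mul_of_le hP hP' h1).1]
    abel
  have hn := 𝒩.norm_sub_le_one hP' hQ' h2
  calc ‖(Q' - P') * X * (Q' - P')‖
      = ‖(Q' - P') * ((Q - P) * X * (Q - P)) * (Q' - P')‖ := by
        congr 1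
        calc (Q' - P') * X * (Q' - P')
            = ((Q' - P') * (Q - P)) * X * ((Q - P) * (Q' - P')) := by rw [e1, e2]
          _ = _ := by simp only [mul_assoc]
    _ ≤ ‖Q' - P'‖ * ‖(Q - P) * X * (Q - P)‖ * ‖Q' - P'‖ :=
        (norm_mul_le _ _).trans (mul_le_mul_of_nonneg_right (norm_mul_le _ _) (norm_nonneg _))
    _ ≤ 1 * ‖(Q - P) * X * (Q - P)‖ * 1 := by gcongr
    _ = _ := by ring

theorem iInf_norm_eq_zero_iff {ι : Type*} [Nonempty ι] (f : ι → H →L[ℂ] H) :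
    (⨅ i, ‖f i‖) = 0 ↔ ∀ ε > 0, ∃ i, ‖f i‖ < ε := by
  have hb : BddBelow (Set.range fun i => ‖f i‖) := ⟨0, by rintro _ ⟨i, rfl⟩; exact norm_nonneg _⟩
  constructor
  · intro h ε hε
    exact exists_lt_of_ciInf_lt (by rw [h]; exact hε)
  · intro h
    refine le_antisymm (le_of_forall_pos_lt_add fun ε hε => ?_)
      (Real.iInf_nonneg fun i => norm_nonneg _)
    obtain ⟨i, hi⟩ := h ε hε
    rw [zero_add]
    exact (ciInf_le hb i).trans_lt hi

theorem iPlus_eq_zero_iff (𝒩 : Nest H) {N : H →L[ℂ] H} (hN : N < 1) (X : H →L[ℂ] H) :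
    𝒩.iPlus N X = 0 ↔
      ∀ ε > 0, ∃ M ∈ 𝒩.carrier, N < M ∧ ‖(M - N) * X * (M - N)‖ < ε := by
  have : Nonempty {M : H →L[ℂ] H // M ∈ 𝒩.carrier ∧ N < M} := ⟨⟨1, 𝒩.one_mem, hN⟩⟩
  rw [iPlus, iInf_norm_eq_zero_iff]
  simp [and_assoc]

theorem iMinus_eq_zero_iff (𝒩 : Nest H) {N : H →L[ℂ] H} (hN : 0 < N) (X : H →L[ℂ] H) :
    𝒩.iMinus N X = 0 ↔
      ∀ ε > 0, ∃ M ∈ 𝒩.carrier, M < N ∧ ‖(N - M) * X * (N - M)‖ < ε := by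
  have : Nonempty {M : H →L[ℂ] H // M ∈ 𝒩.carrier ∧ M < N} := ⟨⟨0, 𝒩.zero_mem, hN⟩⟩
  rw [iMinus, iInf_norm_eq_zero_iff]
  simp [and_assoc]

theorem norm_compress_add_lt {E X Y : H →L[ℂ] H} {ε : ℝ} (hX : ‖E * X * E‖ < ε / 2)
    (hY : ‖E * Y * E‖ < ε / 2) : ‖E * (X + Y) * E‖ < ε := by
  have : E * (X + Y) * E = E * X * E + E * Y * E := by rw [mul_add, add_mul]
  rw [this]
  exact (norm_add_le _ _).trans_lt (by linarith)

/-- The diagonal ideal `I⁺_N = {X ∈ T(𝒩) : i⁺_N(X) = 0}`, for `N < I` in the nest. -/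
noncomputable def idealPlus (𝒩 : Nest H) (N : H →L[ℂ] H) (hN : N ∈ 𝒩.carrier) (hN1 : N < 1) :
    TwoSidedIdeal 𝒩.algebra :=
  TwoSidedIdeal.mk' {X : 𝒩.algebra | 𝒩.iPlus N (X : H →L[ℂ] H) = 0}
    (by
      refine (𝒩.iPlus_eq_zero_iff hN1 _).2 fun ε hε => ⟨1, 𝒩.one_mem, hN1, ?_⟩
      simpa using hε)
    (by
      intro X Y hX hY
      refine (𝒩.iPlus_eq_zero_iff hN1 _).2 fun ε hε => ?_
      obtain ⟨M, hM, hNM, h⟩ := (𝒩.iPlus_eq_zero_iff hN1 _).1 hX (ε / 2) (half_pos hε)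
      obtain ⟨M', hM', hNM', h'⟩ := (𝒩.iPlus_eq_zero_iff hN1 _).1 hY (ε / 2) (half_pos hε)
      rcases 𝒩.total M hM M' hM' with hle | hle
      · exact ⟨M, hM, hNM, norm_compress_add_lt h
          ((𝒩.norm_compress_le hN hN hM' hM le_rfl hNM.le hle _).trans_lt h')⟩
      · exact ⟨M', hM', hNM', norm_compress_add_lt
          ((𝒩.norm_compress_le hN hN hM hM' le_rfl hNM'.le hle _).trans_lt h) h'⟩)
    (by
      intro X hX
      refine (𝒩.iPlus_eq_zero_iff hN1 _).2 fun ε hε => ?_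
      obtain ⟨M, hM, hNM, h⟩ := (𝒩.iPlus_eq_zero_iff hN1 _).1 hX ε hε
      refine ⟨M, hM, hNM, ?_⟩
      simpa only [NegMemClass.coe_neg, mul_neg, neg_mul, norm_neg] using h)
    (by
      intro X Y hY
      refine (𝒩.iPlus_eq_zero_iff hN1 _).2 fun ε hε => ?_
      have hc : 0 < ‖(X : H →L[ℂ] H)‖ + 1 := by positivity
      obtain ⟨M, hM, hNM, h⟩ := (𝒩.iPlus_eq_zero_iff hN1 _).1 hY _ (div_pos hε hc)
      refine ⟨M, hM, hNM, (𝒩.norm_compress_mul_le_left hN hM hNM.le X.2 Y.2).trans_lt ?_⟩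
      rw [lt_div_iff₀ hc] at h
      nlinarith [norm_nonneg ((M - N) * (Y : H →L[ℂ] H) * (M - N))])
    (by
      intro X Y hX
      refine (𝒩.iPlus_eq_zero_iff hN1 _).2 fun ε hε => ?_
      have hc : 0 < ‖(Y : H →L[ℂ] H)‖ + 1 := by positivity
      obtain ⟨M, hM, hNM, h⟩ := (𝒩.iPlus_eq_zero_iff hN1 _).1 hX _ (div_pos hε hc)
      refine ⟨M, hM, hNM, (𝒩.norm_compress_mul_le_right hN hM hNM.le X.2 Y.2).trans_lt ?_⟩
      rw [lt_div_iff₀ hc] at h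
      nlinarith [norm_nonneg ((M - N) * (X : H →L[ℂ] H) * (M - N))])

/-- The diagonal ideal `I⁻_N = {X ∈ T(𝒩) : i⁻_N(X) = 0}`, for `N > 0` in the nest. -/
noncomputable def idealMinus (𝒩 : Nest H) (N : H →L[ℂ] H) (hN : N ∈ 𝒩.carrier) (hN0 : 0 < N) :
    TwoSidedIdeal 𝒩.algebra :=
  TwoSidedIdeal.mk' {X : 𝒩.algebra | 𝒩.iMinus N (X : H →L[ℂ] H) = 0}
    (by
      refine (𝒩.iMinus_eq_zero_iff hN0 _).2 fun ε hε => ⟨0, 𝒩.zero_mem, hN0, ?_⟩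
      simpa using hε)
    (by
      intro X Y hX hY
      refine (𝒩.iMinus_eq_zero_iff hN0 _).2 fun ε hε => ?_
      obtain ⟨M, hM, hMN, h⟩ := (𝒩.iMinus_eq_zero_iff hN0 _).1 hX (ε / 2) (half_pos hε)
      obtain ⟨M', hM', hMN', h'⟩ := (𝒩.iMinus_eq_zero_iff hN0 _).1 hY (ε / 2) (half_pos hε)
      rcases 𝒩.total M hM M' hM' with hle | hle
      · exact ⟨M', hM', hMN', norm_compress_add_lt
          ((𝒩.norm_compress_le hM hM' hN hN hle hMN'.le le_rfl _).trans_lt h) h'⟩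
      · exact ⟨M, hM, hMN, norm_compress_add_lt h
          ((𝒩.norm_compress_le hM' hM hN hN hle hMN.le le_rfl _).trans_lt h')⟩)
    (by
      intro X hX
      refine (𝒩.iMinus_eq_zero_iff hN0 _).2 fun ε hε => ?_
      obtain ⟨M, hM, hMN, h⟩ := (𝒩.iMinus_eq_zero_iff hN0 _).1 hX ε hε
      refine ⟨M, hM, hMN, ?_⟩
      simpa only [NegMemClass.coe_neg, mul_neg, neg_mul, norm_neg] using h)
    (by
      intro X Y hY
      refine (𝒩.iMinus_eq_zero_iff hN0 _).2 fun ε hε => ?_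
      have hc : 0 < ‖(X : H →L[ℂ] H)‖ + 1 := by positivity
      obtain ⟨M, hM, hMN, h⟩ := (𝒩.iMinus_eq_zero_iff hN0 _).1 hY _ (div_pos hε hc)
      refine ⟨M, hM, hMN, (𝒩.norm_compress_mul_le_left hM hN hMN.le X.2 Y.2).trans_lt ?_⟩
      rw [lt_div_iff₀ hc] at h
      nlinarith [norm_nonneg ((N - M) * (Y : H →L[ℂ] H) * (N - M))])
    (by
      intro X Y hX
      refine (𝒩.iMinus_eq_zero_iff hN0 _).2 fun ε hε => ?_
      have hc : 0 < ‖(Y : H →L[ℂ] H)‖ + 1 := by positivity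
      obtain ⟨M, hM, hMN, h⟩ := (𝒩.iMinus_eq_zero_iff hN0 _).1 hX _ (div_pos hε hc)
      refine ⟨M, hM, hMN, (𝒩.norm_compress_mul_le_right hM hN hMN.le X.2 Y.2).trans_lt ?_⟩
      rw [lt_div_iff₀ hc] at h
      nlinarith [norm_nonneg ((N - M) * (X : H →L[ℂ] H) * (N - M))])

/-- The diagonal ideals of the nest algebra are the ideals `I⁺_N` (`N < I`) and
`I⁻_N` (`N > 0`), for `N` in the nest. -/
def IsDiagonalIdeal (𝒩 : Nest H) (J : TwoSidedIdeal 𝒩.algebra) : Prop :=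
  (∃ (N : H →L[ℂ] H) (hN : N ∈ 𝒩.carrier) (hN1 : N < 1), J = 𝒩.idealPlus N hN hN1) ∨
  (∃ (N : H →L[ℂ] H) (hN : N ∈ 𝒩.carrier) (hN0 : 0 < N), J = 𝒩.idealMinus N hN hN0)

end

end Nest

/-- A two-sided ideal of a ring `A` is right-primitive if it is the annihilator of a simple right
`A`-module (a right `A`-module is a module over the opposite ring `Aᵐᵒᵖ`). -/
def IsRightPrimitive.{u} {A : Type u} [Ring A] (J : TwoSidedIdeal A) : Prop :=
  ∃ (V : Type u) (_ : AddCommGroup V) (_ : Module Aᵐᵒᵖ V),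
    IsSimpleModule Aᵐᵒᵖ V ∧ ∀ a : A, a ∈ J ↔ ∀ v : V, MulOpposite.op a • v = 0

/-! Write `A` for the nest algebra and `J` for the diagonal ideal. It suffices to find a proper
right ideal `R ⊇ J` such that every `X ∉ J` admits `B, C ∈ A` with `1 - B X C ∈ R`. A maximal right
ideal `S ⊇ R` then gives the simple module `A / S`: `J` kills it because `J` is two-sided, and an `X
∉ J` killing it would force `1 ∈ S` (`IsRightPrimitive.of_rightIdeal`).

If `N` has an immediate neighbour on the relevant side, `J` is the kernel of compression to an atom
`E`. All rank one operators on the range of `E` lie in `A`, and a fixed unit vector of that range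
defines `R` (`isRightPrimitive_of_atom`).

Otherwise the intervals `E` next to `N` decrease strongly to `0`, and `X ∉ J` means that `‖E X E‖ ≥
δ > 0` for all of them. The core is a family `D` of operators `1 - B X C`, one for each `X ∉ J`,
such that finitely many adjoints from `D` always have a common approximate null unit vector in every
`E`. Then `R` consists of the `Y` for which `E Y* ξ` is small on such vectors `ξ` (`rightIdeal`); it
omits `1` because such vectors exist.

One operator is added to a countable `D` as follows (`exists_approxNull_insert`). Choose successive
blocks carrying approximate null vectors `ξ n` for `D`, and unit vectors `x n`, `g n` with `⟪g n, X
(x n)⟫` bounded below and the cross terms negligible. Operators of `A` can only move vectors one way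
along the nest, so `B X C` cannot in general be made to fix the `ξ n`, but `(B X C)*` can be made
almost a shift on them. Normalised sums of many `ξ n` are then almost fixed by the shift, and remain
approximate null vectors for `D`.

There are at most `2 ^ ℵ₀` operators. Under the Continuum Hypothesis they can be well-ordered with
countable initial segments, so the one-step extension can be iterated over all of them
(`exists_approxNull`). -/

open Filter Topology InnerProductSpace

/-! ### Reduction to a proper right ideal -/

/-- A two-sided ideal `J` contained in a proper right ideal `R` is right-primitive as soon as every
two-sided ideal generated by an element outside `J` is comaximal with `R`. -/
theorem IsRightPrimitive.of_rightIdeal.{u} {A : Type u} [Ring A] (J : TwoSidedIdeal A)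
    (R : Submodule Aᵐᵒᵖ A) (hJ : ∀ a ∈ J, a ∈ R) (h1 : (1 : A) ∉ R)
    (h : ∀ a ∉ J, ∃ b c : A, 1 - b * a * c ∈ R) : IsRightPrimitive J := by
  -- The right module `A` is generated by `1`, so proper submodules lie in maximal ones.
  have hfg : Module.Finite Aᵐᵒᵖ A :=
    ⟨⟨{1}, by
      rw [Finset.coe_singleton, eq_top_iff]
      intro x _
      exact Submodule.mem_span_singleton.2 ⟨MulOpposite.op x, by simp⟩⟩⟩
  have hR : R ≠ ⊤ := fun e => h1 (e ▸ Submodule.mem_top)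
  obtain ⟨S, hS, hRS⟩ := (eq_top_or_exists_le_coatom R).resolve_left hR
  have h1S : (1 : A) ∉ S := fun h1 => hS.1 (by
    rw [eq_top_iff]
    intro x _
    have := S.smul_mem (MulOpposite.op x) h1
    simpa using this)
  refine ⟨A ⧸ S, inferInstance, inferInstance, isSimpleModule_iff_isCoatom.2 hS, fun a => ?_⟩
  constructor
  · intro ha v
    obtain ⟨b, rfl⟩ := Submodule.Quotient.mk_surjective S v
    rw [← Submodule.Quotient.mk_smul, Submodule.Quotient.mk_eq_zero]
    exact hRS (hJ _ (J.mul_mem_left b a ha))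
  · intro ha
    by_contra haJ
    obtain ⟨b, c, hbc⟩ := h a haJ
    have hb := ha (Submodule.Quotient.mk b)
    rw [← Submodule.Quotient.mk_smul, Submodule.Quotient.mk_eq_zero] at hb
    have hbac := S.smul_mem (MulOpposite.op c) hb
    refine h1S ?_
    have := S.add_mem (hRS hbc) hbac
    simpa using this

/-! ### Cardinality: operators on a separable space, and well-orders of type at most `ω₁` -/

/-- A separable metric space has at most continuum many points. -/
theorem Cardinal.mk_le_continuum_of_separable {X : Type*} [MetricSpace X]
    [TopologicalSpace.SeparableSpace X] : #X ≤ 𝔠 := by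
  have : SecondCountableTopology X := UniformSpace.secondCountable_of_separable X
  obtain ⟨b, hbc, -, hb⟩ := TopologicalSpace.exists_countable_basis X
  have hinj : Function.Injective fun x : X => {s : b | x ∈ s.1} := by
    intro x y hxy
    by_contra hne
    obtain ⟨t, ht, hxt, hts⟩ := hb.exists_subset_of_mem_open
      (show x ∈ ({y}ᶜ : Set X) from hne) isOpen_compl_singleton
    have : (⟨t, ht⟩ : b) ∈ {s : b | y ∈ s.1} := by
      have h2 : (⟨t, ht⟩ : b) ∈ {s : b | x ∈ s.1} := hxt
      rwa [show {s : b | x ∈ s.1} = {s : b | y ∈ s.1} from hxy] at h2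
    exact hts this rfl
  refine (Cardinal.mk_le_of_injective hinj).trans ?_
  rw [Cardinal.mk_set, ← Cardinal.two_power_aleph0]
  have : Countable b := hbc
  exact Cardinal.power_le_power_left two_ne_zero Cardinal.mk_le_aleph0

/-- There are at most continuum many bounded operators on a separable space. -/
theorem ContinuousLinearMap.mk_le_continuum {H : Type*} [NormedAddCommGroup H] [NormedSpace ℂ H]
    [TopologicalSpace.SeparableSpace H] : #(H →L[ℂ] H) ≤ 𝔠 := by
  have hinj : Function.Injective
      fun (T : H →L[ℂ] H) (n : ℕ) => T (TopologicalSpace.denseSeq H n) := by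
    intro S T hST
    refine DFunLike.coe_injective (Continuous.ext_on (TopologicalSpace.denseRange_denseSeq H)
      S.continuous T.continuous ?_)
    rintro _ ⟨n, rfl⟩
    exact congrFun hST n
  refine (Cardinal.mk_le_of_injective hinj).trans ?_
  rw [Cardinal.mk_arrow, Cardinal.mk_nat, Cardinal.lift_aleph0, Cardinal.lift_id']
  calc #H ^ ℵ₀ ≤ 𝔠 ^ ℵ₀ := Cardinal.power_le_power_right Cardinal.mk_le_continuum_of_separable
    _ = 𝔠 := Cardinal.continuum_power_aleph0

/-- A type of cardinality at most `ℵ₁` has a well-order all of whose initial segments are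
countable. -/
theorem Cardinal.exists_wellOrder_countable_Iio {ι : Type*} (h : #ι ≤ ℵ₁) :
    ∃ (_ : LinearOrder ι) (_ : WellFoundedLT ι), ∀ i : ι, (Set.Iio i).Countable := by
  obtain ⟨hl, hw, ho⟩ := Cardinal.exists_ord_eq_type_lt ι
  refine ⟨hl, hw, fun i => ?_⟩
  have h2 := (Cardinal.mk_Iio_lt i ho).trans_le h
  rw [← Cardinal.succ_aleph0, Order.lt_succ_iff] at h2
  exact Cardinal.le_aleph0_iff_set_countable.1 h2

/-! ### Diagonal operators between orthonormal sequences -/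

section Diagonal

variable {H : Type*} [NormedAddCommGroup H] [InnerProductSpace ℂ H] [CompleteSpace H]

/-- If `u` and `v` are orthonormal sequences and `a` is bounded, then the series
`∑ aₙ ⟨uₙ, z⟩ vₙ` converges. -/
theorem Orthonormal.summable_smul_inner {u v : ℕ → H} (hu : Orthonormal ℂ u)
    (hv : Orthonormal ℂ v) {a : ℕ → ℂ} {K : ℝ} (ha : ∀ n, ‖a n‖ ≤ K) (z : H) :
    Summable fun n => (a n * ⟪u n, z⟫_ℂ) • v n := by
  have h := hv.orthogonalFamily.summable_iff_norm_sq_summable fun n => a n * ⟪u n, z⟫_ℂ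
  simp only [LinearIsometry.toSpanSingleton_apply] at h
  rw [h]
  refine Summable.of_nonneg_of_le (fun n => sq_nonneg _) (fun n => ?_)
    ((hu.inner_products_summable z).mul_left (K ^ 2))
  rw [norm_mul, mul_pow]
  gcongr
  exact ha n

/-- The operator `∑ aₙ vₙ ⊗ uₙ*` for orthonormal sequences `u`, `v` and bounded `a`. -/
theorem Orthonormal.exists_diagonal {u v : ℕ → H} (hu : Orthonormal ℂ u)
    (hv : Orthonormal ℂ v) {a : ℕ → ℂ} {K : ℝ} (ha : ∀ n, ‖a n‖ ≤ K) :
    ∃ T : H →L[ℂ] H, (∀ z, HasSum (fun n => (a n * ⟪u n, z⟫_ℂ) • v n) (T z)) ∧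
      ∀ w, HasSum (fun n => (starRingEnd ℂ (a n) * ⟪v n, w⟫_ℂ) • u n) (T.adjoint w) := by
  have key : ∀ {u v : ℕ → H} (_ : Orthonormal ℂ u) (_ : Orthonormal ℂ v) {a : ℕ → ℂ}
      (_ : ∀ n, ‖a n‖ ≤ K),
      ∃ T : H →L[ℂ] H, ∀ z, HasSum (fun n => (a n * ⟪u n, z⟫_ℂ) • v n) (T z) := by
    intro u v hu hv a ha
    let g : ℕ → H →L[ℂ] H := fun N =>
      ∑ n ∈ Finset.range N, a n • InnerProductSpace.rankOne ℂ (v n) (u n)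
    have hg : ∀ N z, g N z = ∑ n ∈ Finset.range N, (a n * ⟪u n, z⟫_ℂ) • v n := by
      intro N z
      simp [g, smul_smul]
    have hs := hu.summable_smul_inner hv ha
    -- Boundedness of the pointwise limit comes from the Banach–Steinhaus theorem.
    let T := continuousLinearMapOfTendsto (l := atTop) g
      (f := fun z => ∑' n, (a n * ⟪u n, z⟫_ℂ) • v n) (by
        rw [tendsto_pi_nhds]
        intro z
        simp only [hg]
        exact (hs z).hasSum.tendsto_sum_nat)
    exact ⟨T, fun z => (hs z).hasSum⟩
  obtain ⟨T, hT⟩ := key hu hv ha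
  obtain ⟨S, hS⟩ := key hv hu (a := fun n => starRingEnd ℂ (a n)) (by simpa using ha)
  have hST : S = T.adjoint := by
    rw [ContinuousLinearMap.eq_adjoint_iff]
    intro w z
    have h1 : HasSum (fun n => a n * ⟪u n, z⟫_ℂ * ⟪w, v n⟫_ℂ) ⟪w, T z⟫_ℂ := by
      simpa only [innerSL_apply_apply, inner_smul_right] using (hT z).mapL (innerSL ℂ w)
    have h2 : HasSum (fun n => starRingEnd ℂ (a n) * ⟪v n, w⟫_ℂ * ⟪z, u n⟫_ℂ) ⟪z, S w⟫_ℂ := by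
      simpa only [innerSL_apply_apply, inner_smul_right] using (hS w).mapL (innerSL ℂ z)
    have h3 := h2.map (starRingEnd ℂ) Complex.continuous_conj
    rw [inner_conj_symm] at h3
    refine h3.unique ?_
    convert h1 using 2 with n
    simp only [Function.comp, map_mul, inner_conj_symm, Complex.conj_conj]
    ring
  exact ⟨T, hT, hST ▸ hS⟩

end Diagonal

/-! ### Projections and the filter of small members of a chain -/

section Projection

variable {H : Type*} [NormedAddCommGroup H] [InnerProductSpace ℂ H] [CompleteSpace H]

theorem IsStarProjection.apply_apply {P : H →L[ℂ] H} (hP : IsStarProjection P) (x : H) :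
    P (P x) = P x :=
  congrArg (fun T : H →L[ℂ] H => T x) hP.isIdempotentElem.eq

theorem IsStarProjection.inner_apply_left {P : H →L[ℂ] H} (hP : IsStarProjection P) (x y : H) :
    ⟪P x, y⟫_ℂ = ⟪x, P y⟫_ℂ := by
  have h : P.adjoint = P := hP.isSelfAdjoint
  conv_lhs => rw [← h]
  exact P.adjoint_inner_left y x

theorem IsStarProjection.norm_apply_le {P : H →L[ℂ] H} (hP : IsStarProjection P) (x : H) :
    ‖P x‖ ≤ ‖x‖ := by
  have := P.le_of_opNorm_le hP.norm_le x
  rwa [one_mul] at this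

theorem IsStarProjection.apply_apply_of_le {P Q : H →L[ℂ] H} (hP : IsStarProjection P)
    (hQ : IsStarProjection Q) (h : P ≤ Q) (x : H) : P (Q x) = P x :=
  congrArg (fun T : H →L[ℂ] H => T x) ((hP.le_iff_mul_eq_left hQ).1 h)

theorem IsStarProjection.apply_apply_of_ge {P Q : H →L[ℂ] H} (hP : IsStarProjection P)
    (hQ : IsStarProjection Q) (h : P ≤ Q) (x : H) : Q (P x) = P x :=
  congrArg (fun T : H →L[ℂ] H => T x) ((hP.le_iff_mul_eq_right hQ).1 h)

end Projection

/-- The filter of sections of a totally ordered set of projections, going downwards. -/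
def tailFilter {α : Type*} [Preorder α] (s : Set α) : Filter α :=
  ⨅ a ∈ s, 𝓟 {b ∈ s | b ≤ a}

theorem eventually_tailFilter {α : Type*} [Preorder α] {s : Set α} (hs : s.Nonempty)
    (ht : ∀ a ∈ s, ∀ b ∈ s, a ≤ b ∨ b ≤ a) {p : α → Prop} :
    (∀ᶠ a in tailFilter s, p a) ↔ ∃ a ∈ s, ∀ b ∈ s, b ≤ a → p b := by
  have hdir : DirectedOn ((fun a : α => {b ∈ s | b ≤ a}) ⁻¹'o (fun x y => x ≥ y)) s := by
    intro a ha b hb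
    rcases ht a ha b hb with h | h
    · exact ⟨a, ha, fun c hc => hc, fun c hc => ⟨hc.1, hc.2.trans h⟩⟩
    · exact ⟨b, hb, fun c hc => ⟨hc.1, hc.2.trans h⟩, fun c hc => hc⟩
  have h := hasBasis_biInf_principal hdir hs
  simpa [tailFilter] using h.eventually_iff (q := p)

/-! ### Semi-invariant chains and tails -/

namespace Nest

variable {H : Type*} [NormedAddCommGroup H] [InnerProductSpace ℂ H] [CompleteSpace H]

/-- A nonempty totally ordered set of nonzero projections which are semi-invariant for the nest
algebra. -/
structure IsSemiInvariant (𝒩 : Nest H) (𝓔 : Set (H →L[ℂ] H)) : Prop where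
  nonempty : 𝓔.Nonempty
  isStarProjection : ∀ E ∈ 𝓔, IsStarProjection E
  ne_zero : ∀ E ∈ 𝓔, E ≠ 0
  total : ∀ E ∈ 𝓔, ∀ F ∈ 𝓔, E ≤ F ∨ F ≤ E
  compress_mul : ∀ E ∈ 𝓔, ∀ X ∈ 𝒩.algebra, ∀ Y ∈ 𝒩.algebra,
    E * (X * Y) * E = (E * X * E) * (E * Y * E)

/-- A totally ordered set of semi-invariant projections which decreases strongly to `0`, such that
the nest algebra contains the rank one operators moving the blocks given by the differences of its
members in one direction. -/
structure IsTail (𝒩 : Nest H) (𝓔 : Set (H →L[ℂ] H)) : Prop extends 𝒩.IsSemiInvariant 𝓔 where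
  exists_norm_lt : ∀ (x : H) (ε : ℝ), 0 < ε → ∃ E ∈ 𝓔, ‖E x‖ < ε
  rankOne_mem :
    (∀ E ∈ 𝓔, ∀ F ∈ 𝓔, F ≤ E → ∀ u v : H, F u = u → E v = v → F v = 0 →
      InnerProductSpace.rankOne ℂ u v ∈ 𝒩.algebra) ∨
    (∀ E ∈ 𝓔, ∀ F ∈ 𝓔, F ≤ E → ∀ u v : H, E u = u → F u = 0 → F v = v →
      InnerProductSpace.rankOne ℂ u v ∈ 𝒩.algebra)

/-- The adjoints of the operators in `D` have common approximate null vectors in each of the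
subspaces of the tail `𝓔`. -/
def ApproxNull (𝓔 : Set (H →L[ℂ] H)) (D : Set (H →L[ℂ] H)) : Prop :=
  ∀ S : Finset (H →L[ℂ] H), ↑S ⊆ D → ∀ ε > 0, ∀ E ∈ 𝓔,
    ∃ ξ : H, ‖ξ‖ = 1 ∧ E ξ = ξ ∧ ∀ d ∈ S, ‖d.adjoint ξ‖ < ε

namespace IsSemiInvariant

variable {𝒩 : Nest H} {𝓔 : Set (H →L[ℂ] H)}

theorem eventually_iff (h : 𝒩.IsSemiInvariant 𝓔) {p : (H →L[ℂ] H) → Prop} :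
    (∀ᶠ E in tailFilter 𝓔, p E) ↔ ∃ E ∈ 𝓔, ∀ F ∈ 𝓔, F ≤ E → p F :=
  eventually_tailFilter h.nonempty h.total

theorem exists_of_eventually (h : 𝒩.IsSemiInvariant 𝓔) {p : (H →L[ℂ] H) → Prop}
    (hp : ∀ᶠ E in tailFilter 𝓔, p E) : ∃ E ∈ 𝓔, p E :=
  let ⟨E, hE, hE'⟩ := h.eventually_iff.1 hp
  ⟨E, hE, hE' E hE le_rfl⟩

theorem eventually_le (h : 𝒩.IsSemiInvariant 𝓔) {E : H →L[ℂ] H} (hE : E ∈ 𝓔) :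
    ∀ᶠ F in tailFilter 𝓔, F ≤ E :=
  h.eventually_iff.2 ⟨E, hE, fun _ _ hF => hF⟩

theorem norm_apply_le_of_le (h : 𝒩.IsSemiInvariant 𝓔) {E F : H →L[ℂ] H} (hE : E ∈ 𝓔) (hF : F ∈ 𝓔)
    (hFE : F ≤ E) (x : H) : ‖F x‖ ≤ ‖E x‖ := by
  rw [← (h.isStarProjection F hF).apply_apply_of_le (h.isStarProjection E hE) hFE]
  exact (h.isStarProjection F hF).norm_apply_le _

theorem exists_unit (h : 𝒩.IsSemiInvariant 𝓔) {E : H →L[ℂ] H} (hE : E ∈ 𝓔) :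
    ∃ ξ : H, ‖ξ‖ = 1 ∧ E ξ = ξ := by
  obtain ⟨x, hx⟩ : ∃ x, E x ≠ 0 := by
    by_contra! h0
    exact h.ne_zero E hE (ContinuousLinearMap.ext h0)
  refine ⟨((‖E x‖⁻¹ : ℝ) : ℂ) • E x, ?_, ?_⟩
  · rw [norm_smul, Complex.norm_real, norm_inv, norm_norm, inv_mul_cancel₀ (norm_ne_zero_iff.2 hx)]
  · rw [map_smul, (h.isStarProjection E hE).apply_apply]

end IsSemiInvariant

namespace IsTail

variable {𝒩 : Nest H} {𝓔 : Set (H →L[ℂ] H)}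

theorem eventually_norm_lt (h : 𝒩.IsTail 𝓔) (x : H) {ε : ℝ} (hε : 0 < ε) :
    ∀ᶠ F in tailFilter 𝓔, ‖F x‖ < ε := by
  obtain ⟨E, hE, hx⟩ := h.exists_norm_lt x ε hε
  exact h.eventually_iff.2
    ⟨E, hE, fun F hF hFE => (h.norm_apply_le_of_le hE hF hFE x).trans_lt hx⟩

/-- On a separable space a tail has a countable coinitial subset. -/
theorem exists_coinitial [TopologicalSpace.SeparableSpace H] (h : 𝒩.IsTail 𝓔) :
    ∃ e : ℕ → H →L[ℂ] H, (∀ n, e n ∈ 𝓔) ∧ ∀ E ∈ 𝓔, ∃ n, e n ≤ E := by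
  choose e he hlt using fun p : ℕ × ℕ =>
    h.exists_norm_lt (TopologicalSpace.denseSeq H p.1) (1 / ((p.2 : ℝ) + 1)) (by positivity)
  refine ⟨fun n => e (Nat.unpair n), fun n => he _, fun E hE => ?_⟩
  -- If no `e p` lies below `E`, then `E` lies below all of them and so vanishes on a dense
  -- sequence.
  by_contra! hn
  have hle : ∀ p, E ≤ e p := fun p => by
    have := hn (Nat.pair p.1 p.2)
    rw [Nat.unpair_pair] at this
    exact (h.total E hE _ (he p)).resolve_right this
  refine h.ne_zero E hE (DFunLike.coe_injective (Continuous.ext_on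
    (TopologicalSpace.denseRange_denseSeq H) E.continuous continuous_zero ?_))
  rintro _ ⟨i, rfl⟩
  refine norm_eq_zero.1 (le_antisymm (le_of_forall_pos_lt_add fun ε hε => ?_) (norm_nonneg _))
  obtain ⟨k, hk⟩ := exists_nat_one_div_lt hε
  rw [zero_add]
  exact ((h.norm_apply_le_of_le (he (i, k)) hE (hle (i, k)) _).trans_lt (hlt (i, k))).trans hk

/-- An approximate null vector `ξ` can be cut off to `ξ - F ξ` with `F` far down the tail, since `F
ξ → 0`. The cut vector has norm above `1/2`, so normalising at most doubles the error `ε/4 + ε/4`.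
-/
theorem exists_unit_block (h : 𝒩.IsTail 𝓔) {D : Set (H →L[ℂ] H)} (hD : ApproxNull 𝓔 D)
    {S : Finset (H →L[ℂ] H)} (hS : ↑S ⊆ D) {ε : ℝ} (hε : 0 < ε) {E : H →L[ℂ] H} (hE : E ∈ 𝓔) :
    ∃ F ∈ 𝓔, F ≤ E ∧ ∃ ξ : H, ‖ξ‖ = 1 ∧ E ξ = ξ ∧ F ξ = 0 ∧ ∀ d ∈ S, ‖d.adjoint ξ‖ < ε := by
  obtain ⟨ξ, hξ, hEξ, hd⟩ := hD S hS (ε / 4) (by positivity) E hE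
  have hev : ∀ᶠ F in tailFilter 𝓔, F ≤ E ∧ ‖F ξ‖ < 1 / 2 ∧
      ∀ d ∈ S, ‖F ξ‖ < ε / 4 / (‖d.adjoint‖ + 1) :=
    (h.eventually_le hE).and ((h.eventually_norm_lt ξ (by norm_num)).and
      ((Filter.eventually_all_finset S).2 fun d _ => h.eventually_norm_lt ξ (by positivity)))
  obtain ⟨F, hF, hFE, hF2, hFd⟩ := h.exists_of_eventually hev
  have hEp := h.isStarProjection E hE
  have hFp := h.isStarProjection F hF
  have hn : 1 / 2 < ‖ξ - F ξ‖ := by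
    have := norm_sub_norm_le ξ (F ξ)
    linarith
  have hpos : 0 < ‖ξ - F ξ‖ := by linarith
  refine ⟨F, hF, hFE, ((‖ξ - F ξ‖⁻¹ : ℝ) : ℂ) • (ξ - F ξ), ?_, ?_, ?_, fun d hdS => ?_⟩
  · rw [norm_smul, Complex.norm_real, norm_inv, norm_norm, inv_mul_cancel₀ hpos.ne']
  · rw [map_smul, map_sub, hEξ, hFp.apply_apply_of_ge hEp hFE]
  · rw [map_smul, map_sub, hFp.apply_apply, sub_self, smul_zero]
  · rw [map_smul, norm_smul, Complex.norm_real, norm_inv, norm_norm, inv_mul_lt_iff₀ hpos, map_sub]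
    have h1 := hd d hdS
    have h2 : ‖d.adjoint (F ξ)‖ ≤ ε / 4 := by
      have h3 := (hFd d hdS).le
      rw [le_div_iff₀ (by positivity)] at h3
      have := d.adjoint.le_opNorm (F ξ)
      nlinarith [norm_nonneg (F ξ)]
    have h4 := norm_sub_le (d.adjoint ξ) (d.adjoint (F ξ))
    nlinarith

/-- Take `x` almost realising the norm of `E X E`, cut off its part in a small `F`, and let `g` be
the direction of `(E - F) X x`. The losses are two terms `δ/16`, which brings `δ/2` down to no less
than `δ/4`. -/
theorem exists_pair_block (h : 𝒩.IsTail 𝓔) {X : H →L[ℂ] H} {δ : ℝ} (hδ : 0 < δ)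
    (hX : ∀ E ∈ 𝓔, δ ≤ ‖E * X * E‖) {E : H →L[ℂ] H} (hE : E ∈ 𝓔) :
    ∃ F ∈ 𝓔, F ≤ E ∧ ∃ x g : H, ‖x‖ = 1 ∧ E x = x ∧ F x = 0 ∧ ‖g‖ = 1 ∧ E g = g ∧ F g = 0 ∧
      δ / 4 ≤ ‖⟪g, X x⟫_ℂ‖ := by
  have hEp := h.isStarProjection E hE
  obtain ⟨z, hz⟩ : ∃ z, δ / 2 * ‖z‖ < ‖(E * X * E) z‖ := by
    by_contra! hle
    have := ContinuousLinearMap.opNorm_le_bound _ (by positivity) hle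
    linarith [hX E hE]
  obtain ⟨x, hEx, hx⟩ : ∃ x, E x = x ∧ δ / 2 * ‖x‖ < ‖E (X x)‖ := by
    refine ⟨E z, hEp.apply_apply z, lt_of_le_of_lt ?_ hz⟩
    gcongr
    exact hEp.norm_apply_le z
  have hx0 : 0 < ‖x‖ := by
    rw [norm_pos_iff]
    rintro rfl
    simp at hx
  have hev : ∀ᶠ F in tailFilter 𝓔, F ≤ E ∧ ‖F x‖ < δ / 16 * ‖x‖ / (‖X‖ + 1) ∧
      ‖F (X x)‖ < δ / 16 * ‖x‖ :=
    (h.eventually_le hE).and ((h.eventually_norm_lt x (by positivity)).and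
      (h.eventually_norm_lt (X x) (by positivity)))
  obtain ⟨F, hF, hFE, hFx, hFX⟩ := h.exists_of_eventually hev
  have hFp := h.isStarProjection F hF
  have hXF : ‖X (F x)‖ ≤ δ / 16 * ‖x‖ := by
    have h3 := hFx.le
    rw [le_div_iff₀ (by positivity)] at h3
    have := X.le_opNorm (F x)
    nlinarith [norm_nonneg (F x)]
  have hQ : IsStarProjection (E - F) := (hFp.le_iff_sub hEp).1 hFE
  set x' := x - F x with hx'
  set y := (E - F) (X x') with hy
  have hyn : δ / 4 * ‖x‖ ≤ ‖y‖ := by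
    have e : E (X x) = y + F (X x) + (E - F) (X (F x)) := by
      simp only [hy, hx', sub_apply, map_sub]
      abel
    have h1 := norm_add₃_le (a := y) (b := F (X x)) (c := (E - F) (X (F x)))
    have h2 := hQ.norm_apply_le (X (F x))
    rw [← e] at h1
    nlinarith
  have hx'le : ‖x'‖ ≤ ‖x‖ := by
    have : x' = (E - F) x := by rw [sub_apply, hEx]
    rw [this]
    exact hQ.norm_apply_le x
  have hEF : ∀ w, E (F w) = F w := hFp.apply_apply_of_ge hEp hFE
  have hFE' : ∀ w, F (E w) = F w := hFp.apply_apply_of_le hEp hFE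
  have hEy : E y = y := by simp only [hy, sub_apply, map_sub E, hEp.apply_apply, hEF]
  have hFy : F y = 0 := by
    simp only [hy, sub_apply, map_sub F, hFE', hFp.apply_apply, sub_self]
  have hypos : 0 < ‖y‖ := lt_of_lt_of_le (by positivity) hyn
  have hx'pos : 0 < ‖x'‖ := by
    rw [norm_pos_iff]
    intro h0
    rw [hy, h0] at hypos
    simp at hypos
  refine ⟨F, hF, hFE, ((‖x'‖⁻¹ : ℝ) : ℂ) • x', ((‖y‖⁻¹ : ℝ) : ℂ) • y, ?_, ?_, ?_, ?_, ?_, ?_, ?_⟩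
  · rw [norm_smul, Complex.norm_real, norm_inv, norm_norm, inv_mul_cancel₀ hx'pos.ne']
  · rw [map_smul, hx', map_sub, hEx, hEF]
  · rw [map_smul, hx', map_sub, hFp.apply_apply, sub_self, smul_zero]
  · rw [norm_smul, Complex.norm_real, norm_inv, norm_norm, inv_mul_cancel₀ hypos.ne']
  · rw [map_smul, hEy]
  · rw [map_smul, hFy, smul_zero]
  -- As `y` is the compression of `X x'`, this inner product is `‖y‖ ^ 2`; after normalisation it
  -- becomes `‖y‖ / ‖x'‖`.
  · have hyy : ⟪y, X x'⟫_ℂ = (‖y‖ : ℂ) ^ 2 := by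
      refine Eq.trans ?_ (inner_self_eq_norm_sq_to_K (𝕜 := ℂ) y)
      have h1 : (E - F) y = y := by rw [sub_apply, hEy, hFy, sub_zero]
      calc ⟪y, X x'⟫_ℂ = ⟪(E - F) y, X x'⟫_ℂ := by rw [h1]
        _ = ⟪y, y⟫_ℂ := hQ.inner_apply_left _ _
    rw [map_smul, inner_smul_left, inner_smul_right, hyy, Complex.conj_ofReal, norm_mul, norm_mul,
      norm_pow, Complex.norm_real, Complex.norm_real, Complex.norm_real, norm_inv, norm_inv,
      norm_norm, norm_norm]
    have : ‖y‖⁻¹ * (‖x'‖⁻¹ * ‖y‖ ^ 2) = ‖y‖ / ‖x'‖ := by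
      field_simp
    rw [this, le_div_iff₀ hx'pos]
    nlinarith

end IsTail

end Nest

/-! ### Averages of an approximate shift -/

/-- If `T` almost maps each member of an orthonormal sequence to its successor, or to its
predecessor, then `1 - T` is small on long averages of the sequence. -/
theorem ContinuousLinearMap.norm_sum_sub_le {H : Type*} [NormedAddCommGroup H] [NormedSpace ℂ H]
    {v : ℕ → H} (hv : ∀ n, ‖v n‖ = 1) {T : H →L[ℂ] H} {K : ℝ} {p q : ℕ}
    (hpq : p = 0 ∧ q = 1 ∨ p = 1 ∧ q = 0)
    (hT : ∀ m, ‖T (v (m + q)) - v (m + p)‖ ≤ K * (1 / 2) ^ m) (s L : ℕ) :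
    ‖∑ m ∈ Finset.range L, v (s + m + q) - T (∑ m ∈ Finset.range L, v (s + m + q))‖ ≤
      2 * K + 2 := by
  have hK : 0 ≤ K := by
    have := (norm_nonneg _).trans (hT 0)
    simpa using this
  -- The exact shift contributes a telescoping sum, of norm at most `2`; the errors contribute a
  -- geometric series, at most `2 * K`.
  have e : ∑ m ∈ Finset.range L, v (s + m + q) - T (∑ m ∈ Finset.range L, v (s + m + q)) =
      (∑ m ∈ Finset.range L, (v (s + m + q) - v (s + m + p))) -
        ∑ m ∈ Finset.range L, (T (v (s + m + q)) - v (s + m + p)) := by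
    rw [map_sum, ← Finset.sum_sub_distrib, ← Finset.sum_sub_distrib]
    exact Finset.sum_congr rfl fun m _ => by abel
  have h1 : ‖∑ m ∈ Finset.range L, (v (s + m + q) - v (s + m + p))‖ ≤ 2 := by
    rcases hpq with ⟨rfl, rfl⟩ | ⟨rfl, rfl⟩
    · have := Finset.sum_range_sub (fun m => v (s + m)) L
      simp only [← add_assoc, add_zero] at this ⊢
      rw [this]
      exact (norm_sub_le _ _).trans (by rw [hv, hv]; norm_num)
    · have := Finset.sum_range_sub' (fun m => v (s + m)) L
      simp only [← add_assoc, add_zero] at this ⊢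
      rw [this]
      exact (norm_sub_le _ _).trans (by rw [hv, hv]; norm_num)
  have h2 : ‖∑ m ∈ Finset.range L, (T (v (s + m + q)) - v (s + m + p))‖ ≤ 2 * K := by
    calc _ ≤ ∑ m ∈ Finset.range L, K * (1 / 2 : ℝ) ^ m := by
          refine norm_sum_le_of_le _ fun m _ => (hT (s + m)).trans ?_
          exact mul_le_mul_of_nonneg_left
            (pow_le_pow_of_le_one (by norm_num) (by norm_num) (by lia)) hK
      _ = K * ∑ m ∈ Finset.range L, (1 / 2 : ℝ) ^ m := by rw [Finset.mul_sum]
      _ ≤ K * 2 := by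
          gcongr
          exact sum_geometric_two_le L
      _ = 2 * K := mul_comm _ _
  rw [e]
  exact (norm_sub_le _ _).trans (by linarith)

namespace Nest

variable {H : Type*} [NormedAddCommGroup H] [InnerProductSpace ℂ H] [CompleteSpace H]

theorem mem_algebra_iff {𝒩 : Nest H} {X : H →L[ℂ] H} :
    X ∈ 𝒩.algebra ↔ ∀ P ∈ 𝒩.carrier, ∀ z, P z = z → P (X z) = X z := by
  constructor
  · intro hX P hP z hz
    obtain ⟨y, hy⟩ := hX P hP ⟨z, hz⟩
    rw [← hy, (𝒩.isStarProjection P hP).apply_apply]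
  · rintro h P hP _ ⟨z, rfl⟩
    exact ⟨X (P z), h P hP _ ((𝒩.isStarProjection P hP).apply_apply z)⟩

/-- The nest algebra is closed under strongly convergent sums. -/
theorem mem_algebra_of_hasSum {𝒩 : Nest H} {ι : Type*} {f : ι → H →L[ℂ] H} {T : H →L[ℂ] H}
    (hf : ∀ i, f i ∈ 𝒩.algebra) (hT : ∀ z, HasSum (fun i => f i z) (T z)) : T ∈ 𝒩.algebra := by
  rw [mem_algebra_iff]
  intro P hP z hz
  refine ((hT z).mapL P).unique ?_
  convert hT z using 2 with i
  exact mem_algebra_iff.1 (hf i) P hP z hz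

/-! ### Sequences of almost non-interacting blocks -/

/-- Three consecutive members `E ≥ F ≥ G` of a tail with a unit vector `ξ` in the first block and
unit vectors `x`, `g` in the second one. -/
structure Block (H : Type*) [NormedAddCommGroup H] [InnerProductSpace ℂ H] [CompleteSpace H] where
  k : ℕ
  E : H →L[ℂ] H
  F : H →L[ℂ] H
  G : H →L[ℂ] H
  ξ : H
  x : H
  g : H
  a : ℂ

/-- The vector `ξ` is almost annihilated by `(d i)*`, `i ≤ k`, while `X` maps `x` to a vector with
a component along `g`, normalised by `a`. -/
structure Block.Adapted (𝓔 : Set (H →L[ℂ] H)) (e d : ℕ → H →L[ℂ] H) (X : H →L[ℂ] H) (K : ℝ)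
    (b : Block H) : Prop where
  E_mem : b.E ∈ 𝓔
  F_mem : b.F ∈ 𝓔
  G_mem : b.G ∈ 𝓔
  F_le : b.F ≤ b.E
  G_le : b.G ≤ b.F
  E_le : ∀ i ≤ b.k, b.E ≤ e i
  norm_ξ : ‖b.ξ‖ = 1
  E_ξ : b.E b.ξ = b.ξ
  F_ξ : b.F b.ξ = 0
  norm_x : ‖b.x‖ = 1
  F_x : b.F b.x = b.x
  G_x : b.G b.x = 0
  norm_g : ‖b.g‖ = 1
  F_g : b.F b.g = b.g
  G_g : b.G b.g = 0
  a_mul : b.a * ⟪b.g, X b.x⟫_ℂ = 1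
  norm_a : ‖b.a‖ ≤ K
  norm_d : ∀ i ≤ b.k, ‖(d i).adjoint b.ξ‖ ≤ (1 / 4) ^ b.k

/-- The block `c` comes after the block `b`, and `X` almost does not interlace them. -/
structure Block.Before (X : H →L[ℂ] H) (b c : Block H) : Prop where
  k_lt : b.k < c.k
  E_le : c.E ≤ b.G
  inner_left : ‖b.a * ⟪c.g, X b.x⟫_ℂ‖ ≤ (1 / 4) ^ c.k
  inner_right : ‖c.a * ⟪b.g, X c.x⟫_ℂ‖ ≤ (1 / 4) ^ c.k

namespace IsTail

variable {𝒩 : Nest H} {𝓔 : Set (H →L[ℂ] H)}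

/-- The new block is placed so deep in the tail that its first projection lies under all earlier
blocks, and its second one almost kills `X b.x` and `X* b.g` for every earlier `b`. As the new `x`
and `g` lie in the range of that second projection, both cross terms are small. -/
theorem exists_block (h : 𝒩.IsTail 𝓔) {e d : ℕ → H →L[ℂ] H} (he : ∀ n, e n ∈ 𝓔)
    (hd : ApproxNull 𝓔 (Set.range d)) {X : H →L[ℂ] H} {δ : ℝ} (hδ : 0 < δ)
    (hX : ∀ E ∈ 𝓔, δ ≤ ‖E * X * E‖) (s : Finset (Block H))
    (hs : ∀ b ∈ s, b.Adapted 𝓔 e d X (4 / δ)) :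
    ∃ c : Block H, c.Adapted 𝓔 e d X (4 / δ) ∧ ∀ b ∈ s, b.Before X c := by
  classical
  set k := s.sup Block.k + 1 with hk
  have hev : ∀ᶠ E in tailFilter 𝓔, (∀ b ∈ s, E ≤ b.G) ∧ ∀ i ∈ Finset.range (k + 1), E ≤ e i :=
    ((Filter.eventually_all_finset s).2 fun b hb => h.eventually_le (hs b hb).G_mem).and
      ((Filter.eventually_all_finset _).2 fun i _ => h.eventually_le (he i))
  obtain ⟨E, hE, hEs, hEe⟩ := h.exists_of_eventually hev
  obtain ⟨F₀, hF₀, hF₀E, ξ, hξ, hEξ, hFξ, hdξ⟩ := h.exists_unit_block hd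
    (S := (Finset.range (k + 1)).image d)
    (by rw [Finset.coe_image]; exact Set.image_subset_range _ _)
    (ε := (1 / 4) ^ k) (by positivity) hE
  -- The division by `4 / δ` compensates for the bound on the normalising coefficients `a`.
  have hev : ∀ᶠ F in tailFilter 𝓔, F ≤ F₀ ∧ ∀ b ∈ s, ‖F (X b.x)‖ < (1 / 4) ^ k / (4 / δ) ∧
      ‖F (X.adjoint b.g)‖ < (1 / 4) ^ k / (4 / δ) :=
    (h.eventually_le hF₀).and ((Filter.eventually_all_finset s).2 fun b _ =>
      (h.eventually_norm_lt _ (by positivity)).and (h.eventually_norm_lt _ (by positivity)))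
  obtain ⟨F, hF, hFF₀, hFs⟩ := h.exists_of_eventually hev
  obtain ⟨G, hG, hGF, x, g, hx, hFx, hGx, hg, hFg, hGg, hgx⟩ := h.exists_pair_block hδ hX hF
  have hFp := h.isStarProjection F hF
  have hne : ⟪g, X x⟫_ℂ ≠ 0 := by
    rw [← norm_pos_iff]
    exact lt_of_lt_of_le (by positivity) hgx
  have ha : ‖(⟪g, X x⟫_ℂ)⁻¹‖ ≤ 4 / δ := by
    rw [norm_inv, ← inv_div]
    exact inv_anti₀ (by positivity) hgx
  refine ⟨⟨k, E, F, G, ξ, x, g, (⟪g, X x⟫_ℂ)⁻¹⟩, ?_, fun b hb => ?_⟩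
  · refine ⟨hE, hF, hG, hFF₀.trans hF₀E, hGF, fun i hi => hEe i (by simpa using hi), hξ, hEξ, ?_,
      hx, hFx, hGx, hg, hFg, hGg, inv_mul_cancel₀ hne, ha, fun i hi => (hdξ _ ?_).le⟩
    · have := h.norm_apply_le_of_le hF₀ hF hFF₀ ξ
      rw [hFξ, norm_zero] at this
      exact norm_le_zero_iff.1 this
    · exact Finset.mem_image_of_mem _ (Finset.mem_range.2 (Nat.lt_succ_of_le hi))
  · have hb' := hs b hb
    obtain ⟨h1, h2⟩ := hFs b hb
    rw [lt_div_iff₀ (by positivity)] at h1 h2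
    refine ⟨Nat.lt_succ_of_le (Finset.le_sup (f := Block.k) hb), hEs b hb, ?_, ?_⟩
    · have h3 : ‖⟪g, X b.x⟫_ℂ‖ ≤ ‖F (X b.x)‖ := by
        rw [← hFg, hFp.inner_apply_left]
        simpa [hg] using norm_inner_le_norm (𝕜 := ℂ) g (F (X b.x))
      rw [norm_mul]
      have := mul_le_mul hb'.norm_a h3 (norm_nonneg _) (by positivity)
      linarith
    · have h3 : ‖⟪b.g, X x⟫_ℂ‖ ≤ ‖F (X.adjoint b.g)‖ := by
        rw [← X.adjoint_inner_left, ← hFx, ← hFp.inner_apply_left]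
        simpa [hx] using norm_inner_le_norm (𝕜 := ℂ) (F (X.adjoint b.g)) x
      rw [norm_mul]
      have := mul_le_mul ha h3 (norm_nonneg _) (by positivity)
      linarith

/-- A sequence of blocks as provided by `exists_block`. -/
theorem exists_blocks (h : 𝒩.IsTail 𝓔) {e d : ℕ → H →L[ℂ] H} (he : ∀ n, e n ∈ 𝓔)
    (hd : ApproxNull 𝓔 (Set.range d)) {X : H →L[ℂ] H} {δ : ℝ} (hδ : 0 < δ)
    (hX : ∀ E ∈ 𝓔, δ ≤ ‖E * X * E‖) :
    ∃ b : ℕ → Block H, (∀ n, (b n).Adapted 𝓔 e d X (4 / δ)) ∧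
      ∀ m n, m < n → (b m).Before X (b n) :=
  exists_seq_of_forall_finset_exists _ _ fun s hs => h.exists_block he hd hδ hX s hs

end IsTail

end Nest

theorem orthonormal_of_forall_lt {H : Type*} [NormedAddCommGroup H] [InnerProductSpace ℂ H]
    {v : ℕ → H} (h1 : ∀ n, ‖v n‖ = 1) (h : ∀ m n, m < n → ⟪v m, v n⟫_ℂ = 0) :
    Orthonormal ℂ v := by
  refine ⟨h1, fun m n hmn => ?_⟩
  rcases hmn.lt_or_gt with hlt | hlt
  · exact h m n hlt
  · exact inner_eq_zero_symm.1 (h n m hlt)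

theorem Orthonormal.norm_sum_sq {H ι : Type*} [NormedAddCommGroup H] [InnerProductSpace ℂ H]
    {v : ι → H} (hv : Orthonormal ℂ v) (s : Finset ι) : ‖∑ i ∈ s, v i‖ ^ 2 = s.card := by
  have h := hv.inner_sum (fun _ => 1) (fun _ => 1) s
  simp only [one_smul, map_one, mul_one, Finset.sum_const, nsmul_eq_mul] at h
  have h2 := inner_self_eq_norm_sq_to_K (𝕜 := ℂ) (∑ i ∈ s, v i)
  rw [h] at h2
  exact Complex.ofReal_injective (by simpa using h2.symm)

/-! ### Adding one operator to a countable family -/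

namespace Nest

variable {H : Type*} [NormedAddCommGroup H] [InnerProductSpace ℂ H] [CompleteSpace H]

theorem ApproxNull.insert_zero {𝓔 D : Set (H →L[ℂ] H)} (hD : ApproxNull 𝓔 D) :
    ApproxNull 𝓔 (insert 0 D) := by
  classical
  intro S hS ε hε E hE
  obtain ⟨ξ, h1, h2, h3⟩ := hD (S.erase 0) (fun d hd => by
    rw [Finset.coe_erase] at hd
    exact (hS hd.1).resolve_left hd.2) ε hε E hE
  refine ⟨ξ, h1, h2, fun d hd => ?_⟩
  by_cases h0 : d = 0
  · simpa [h0] using hε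
  · exact h3 d (Finset.mem_erase.2 ⟨h0, hd⟩)

namespace IsTail

variable {𝒩 : Nest H} {𝓔 : Set (H →L[ℂ] H)}

/-- Orthogonality of vectors in different blocks. -/
theorem inner_eq_zero_of_before (h : 𝒩.IsTail 𝓔) {X : H →L[ℂ] H} {b c : Block H}
    (hG : b.G ∈ 𝓔) (hE : c.E ∈ 𝓔) (hbc : b.Before X c) {u v : H} (hu : b.G u = 0)
    (hv : c.E v = v) : ⟪u, v⟫_ℂ = 0 := by
  have hGp := h.isStarProjection _ hG
  have : b.G v = v := by
    rw [← hv]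
    exact (h.isStarProjection _ hE).apply_apply_of_ge hGp hbc.E_le v
  rw [← this, ← hGp.inner_apply_left, hu, inner_zero_left]

/-- The family `D` of operators with common approximate null vectors can be enlarged by an operator
`1 - B X C`. -/
theorem exists_approxNull_insert [TopologicalSpace.SeparableSpace H] (h : 𝒩.IsTail 𝓔)
    {D : Set (H →L[ℂ] H)} (hDc : D.Countable) (hD : ApproxNull 𝓔 D) {X : H →L[ℂ] H} {δ : ℝ}
    (hδ : 0 < δ) (hX : ∀ E ∈ 𝓔, δ ≤ ‖E * X * E‖) :
    ∃ B ∈ 𝒩.algebra, ∃ C ∈ 𝒩.algebra, ApproxNull 𝓔 (insert (1 - B * X * C) D) := by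
  obtain ⟨e, he, hecof⟩ := h.exists_coinitial
  -- Adding `0` makes the family nonempty, hence the range of a sequence.
  obtain ⟨d, hd⟩ := (hDc.insert 0).exists_eq_range (Set.insert_nonempty 0 D)
  obtain ⟨b, hb, hbb⟩ := h.exists_blocks he (hd ▸ hD.insert_zero) hδ hX
  have hmono : StrictMono fun n => (b n).k :=
    strictMono_nat_of_lt_succ fun n => (hbb n (n + 1) n.lt_succ_self).k_lt
  have hk : ∀ n, n ≤ (b n).k := fun n => hmono.le_apply
  have hEp := fun n => h.isStarProjection _ (hb n).E_mem
  have hFp := fun n => h.isStarProjection _ (hb n).F_mem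
  have hGp := fun n => h.isStarProjection _ (hb n).G_mem
  have hGξ : ∀ n, (b n).G (b n).ξ = 0 := fun n => by
    rw [← (hGp n).apply_apply_of_le (hFp n) (hb n).G_le, (hb n).F_ξ, map_zero]
  have hEx : ∀ n, (b n).E (b n).x = (b n).x := fun n => by
    rw [← (hb n).F_x]
    exact (hFp n).apply_apply_of_ge (hEp n) (hb n).F_le _
  have hEg : ∀ n, (b n).E (b n).g = (b n).g := fun n => by
    rw [← (hb n).F_g]
    exact (hFp n).apply_apply_of_ge (hEp n) (hb n).F_le _
  have horth : ∀ v : Block H → H, (∀ n, ‖v (b n)‖ = 1) → (∀ n, (b n).G (v (b n)) = 0) →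
      (∀ n, (b n).E (v (b n)) = v (b n)) → Orthonormal ℂ fun n => v (b n) :=
    fun v h1 hG hE => orthonormal_of_forall_lt h1 fun m n hmn =>
      h.inner_eq_zero_of_before (hb m).G_mem (hb n).E_mem (hbb m n hmn) (hG m) (hE n)
  have hξo := horth Block.ξ (fun n => (hb n).norm_ξ) hGξ fun n => (hb n).E_ξ
  have hxo := horth Block.x (fun n => (hb n).norm_x) (fun n => (hb n).G_x) hEx
  have hgo := horth Block.g (fun n => (hb n).norm_g) (fun n => (hb n).G_g) hEg
  have hGE : ∀ n, (b (n + 1)).E ≤ (b n).G := fun n => (hbb n (n + 1) n.lt_succ_self).E_le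
  have hGξ' : ∀ n, (b n).G (b (n + 1)).ξ = (b (n + 1)).ξ := fun n => by
    conv_lhs => rw [← (hb (n + 1)).E_ξ]
    rw [(hEp (n + 1)).apply_apply_of_ge (hGp n) (hGE n), (hb (n + 1)).E_ξ]
  -- `C` sends `ξ (n + p)` to a multiple of `x n`, and `B` sends `g n` to `ξ (n + q)`. Both must
  -- move along the tail in the direction the nest algebra allows: deeper for `p = 0, q = 1`,
  -- outwards for `p = 1, q = 0`.
  obtain ⟨p, q, hpq, hC, hB⟩ : ∃ p q : ℕ, (p = 0 ∧ q = 1 ∨ p = 1 ∧ q = 0) ∧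
      (∀ n, InnerProductSpace.rankOne ℂ (b n).x (b (n + p)).ξ ∈ 𝒩.algebra) ∧
      ∀ n, InnerProductSpace.rankOne ℂ (b (n + q)).ξ (b n).g ∈ 𝒩.algebra := by
    rcases h.rankOne_mem with hr | hr
    · exact ⟨0, 1, Or.inl ⟨rfl, rfl⟩,
        fun n => hr _ (hb n).E_mem _ (hb n).F_mem (hb n).F_le _ _ (hb n).F_x (hb n).E_ξ (hb n).F_ξ,
        fun n => hr _ (hb n).F_mem _ (hb n).G_mem (hb n).G_le _ _ (hGξ' n) (hb n).F_g (hb n).G_g⟩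
    · exact ⟨1, 0, Or.inr ⟨rfl, rfl⟩,
        fun n => hr _ (hb n).F_mem _ (hb n).G_mem (hb n).G_le _ _ (hb n).F_x (hb n).G_x (hGξ' n),
        fun n => hr _ (hb n).E_mem _ (hb n).F_mem (hb n).F_le _ _ (hb n).E_ξ (hb n).F_ξ (hb n).F_g⟩
  have hξp := hξo.comp (· + p) (add_left_injective p)
  have hξq := hξo.comp (· + q) (add_left_injective q)
  obtain ⟨C, hCs, hCa⟩ := hξp.exists_diagonal hxo (a := fun n => (b n).a) fun n => (hb n).norm_a
  obtain ⟨B, hBs, hBa⟩ := hgo.exists_diagonal hξq (a := fun _ => 1) (K := 1) (by simp)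
  have hCA : C ∈ 𝒩.algebra := mem_algebra_of_hasSum
    (fun n => 𝒩.algebra.smul_mem (hC n) (b n).a) fun z => by
      simpa [smul_smul] using hCs z
  have hBA : B ∈ 𝒩.algebra := mem_algebra_of_hasSum hB fun z => by simpa using hBs z
  refine ⟨B, hBA, C, hCA, ?_⟩
  set T := (B * X * C).adjoint with hT
  -- `T` is almost a shift: `B* ξ (m + q) = g m`, and in the series for `C* (X* (g m))` the term `n
  -- = m` is exactly `ξ (m + p)` by the choice of `a m`. The other terms are at most `(1/2) ^ m *
  -- (1/2) ^ n`.
  have hTm : ∀ m, ‖T (b (m + q)).ξ - (b (m + p)).ξ‖ ≤ 2 * (1 / 2) ^ m := by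
    intro m
    have hBm : B.adjoint (b (m + q)).ξ = (b m).g := by
      refine (hBa _).unique ?_
      convert hasSum_ite_eq m (b m).g using 2 with n
      have := orthonormal_iff_ite.1 hξq n m
      simp only [Function.comp] at this
      simp only [Function.comp, map_one, one_mul, this]
      split_ifs with hnm
      · rw [hnm, one_smul]
      · rw [zero_smul]
    have hTm : T (b (m + q)).ξ = C.adjoint (X.adjoint (b m).g) := by
      rw [hT, ← hBm]
      simp only [ContinuousLinearMap.mul_def, ContinuousLinearMap.adjoint_comp,
        ContinuousLinearMap.comp_apply]
    rw [hTm]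
    refine ((hCa (X.adjoint (b m).g)).sub (hasSum_ite_eq m (b (m + p)).ξ)).norm_le_of_bounded
      ((hasSum_geometric_two.mul_left ((1 / 2 : ℝ) ^ m))) (fun n => ?_) |>.trans_eq (mul_comm _ _)
    have hc : starRingEnd ℂ (b n).a * ⟪(b n).x, X.adjoint (b m).g⟫_ℂ =
        starRingEnd ℂ ((b n).a * ⟪(b m).g, X (b n).x⟫_ℂ) := by
      rw [map_mul, inner_conj_symm, X.adjoint_inner_right]
    rw [hc]
    by_cases hnm : n = m
    · subst hnm
      rw [(hb n).a_mul]
      simp only [map_one, one_smul, Function.comp, if_true, sub_self, norm_zero]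
      positivity
    · rw [if_neg hnm, sub_zero, norm_smul, RCLike.norm_conj]
      simp only [Function.comp]
      rw [(hb (n + p)).norm_ξ, mul_one]
      have hpow : ∀ r s k : ℕ, r ≤ s → s ≤ k →
          (1 / 4 : ℝ) ^ k ≤ (1 / 2) ^ s * (1 / 2) ^ r := by
        intro r s k hrs hsk
        calc (1 / 4 : ℝ) ^ k ≤ (1 / 4) ^ s :=
              pow_le_pow_of_le_one (by norm_num) (by norm_num) hsk
          _ = (1 / 2) ^ s * (1 / 2) ^ s := by rw [← mul_pow]; norm_num
          _ ≤ (1 / 2) ^ s * (1 / 2) ^ r := by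
              gcongr (1 / 2) ^ s * ?_
              exact pow_le_pow_of_le_one (by norm_num) (by norm_num) hrs
      rcases lt_or_gt_of_ne hnm with hlt | hlt
      · exact (hbb n m hlt).inner_left.trans (hpow n m _ hlt.le (hk m))
      · rw [mul_comm ((1 / 2 : ℝ) ^ m)]
        exact (hbb m n hlt).inner_right.trans (hpow m n _ hlt.le (hk n))
  intro S hS ε hε E hE
  obtain ⟨n₀, hn₀⟩ := hecof E hE
  have hidx : ∀ c ∈ S, ∃ i, c = 1 - B * X * C ∨ d i = c := by
    intro c hc
    rcases hS hc with hc' | hc'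
    · exact ⟨0, Or.inl hc'⟩
    · obtain ⟨i, hi⟩ : c ∈ Set.range d := hd ▸ Set.mem_insert_of_mem 0 hc'
      exact ⟨i, Or.inr hi⟩
  choose! i hi using hidx
  -- Beyond `s`, every `ξ` lies in the range of `E` and the bounds `norm_d` cover all members of `S`
  -- taken from `D`.
  set s := max n₀ (S.sup i) with hs
  -- A sum of `N ^ 2` orthonormal vectors has norm `N`, while the adjoints in `S` map it to vectors
  -- of norm at most `6 = 2 * 2 + 2`, the bound of `norm_sum_sub_le` for `K = 2`.
  obtain ⟨N, hN⟩ := exists_nat_gt (6 / ε)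
  have hN0 : (0 : ℝ) < N := lt_trans (by positivity) hN
  have hN6 : (N : ℝ)⁻¹ * 6 < ε := by
    rw [inv_mul_lt_iff₀ hN0]
    rwa [div_lt_iff₀ hε] at hN
  set v := ∑ m ∈ Finset.range (N ^ 2), (b (s + m + q)).ξ with hv
  have hvn : ‖v‖ = N := by
    have := (hξo.comp (fun m => s + m + q) fun m n hmn => by simpa using hmn).norm_sum_sq
      (Finset.range (N ^ 2))
    rw [Finset.card_range] at this
    push_cast at this
    exact (pow_left_inj₀ (norm_nonneg _) hN0.le two_ne_zero).1 this
  have hEv : E v = v := by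
    rw [hv, map_sum]
    refine Finset.sum_congr rfl fun m _ => ?_
    have hle : (b (s + m + q)).E ≤ E :=
      ((hb _).E_le n₀ ((show n₀ ≤ s + m + q by omega).trans (hk _))).trans hn₀
    conv_lhs => rw [← (hb _).E_ξ]
    rw [(hEp _).apply_apply_of_ge (h.isStarProjection E hE) hle, (hb _).E_ξ]
  have hscale : ∀ c : H →L[ℂ] H, ‖c.adjoint v‖ ≤ 6 →
      ‖c.adjoint ((((N : ℝ)⁻¹ : ℝ) : ℂ) • v)‖ < ε := by
    intro c hc
    rw [map_smul, norm_smul, Complex.norm_real, norm_inv, Real.norm_of_nonneg hN0.le]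
    exact lt_of_le_of_lt (by gcongr) hN6
  refine ⟨(((N : ℝ)⁻¹ : ℝ) : ℂ) • v, ?_, ?_, fun c hc => hscale c ?_⟩
  · rw [norm_smul, Complex.norm_real, norm_inv, Real.norm_of_nonneg hN0.le, hvn,
      inv_mul_cancel₀ hN0.ne']
  · rw [map_smul, hEv]
  · rcases hi c hc with rfl | hdi
    · have := ContinuousLinearMap.norm_sum_sub_le (fun n => (hb n).norm_ξ) hpq hTm s (N ^ 2)
      have e1 : (1 - B * X * C).adjoint v = v - T v := by
        rw [map_sub, sub_apply, ← hT]
        congr 1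
        have h1 : (1 : H →L[ℂ] H).adjoint = 1 := star_one (H →L[ℂ] H)
        rw [h1]
        rfl
      rw [e1]
      exact this.trans (by norm_num)
    · rw [← hdi, hv, map_sum]
      calc _ ≤ ∑ m ∈ Finset.range (N ^ 2), (1 / 2 : ℝ) ^ m := by
            refine norm_sum_le_of_le _ fun m _ => ?_
            have hk' := hk (s + m + q)
            have his : i c ≤ s := (Finset.le_sup hc).trans (le_max_right _ _)
            refine ((hb _).norm_d (i c) (by omega)).trans ?_
            calc (1 / 4 : ℝ) ^ (b (s + m + q)).k ≤ (1 / 2) ^ (b (s + m + q)).k := by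
                  gcongr; norm_num
              _ ≤ (1 / 2) ^ m := pow_le_pow_of_le_one (by norm_num) (by norm_num) (by omega)
        _ ≤ 2 := sum_geometric_two_le _
        _ ≤ 6 := by norm_num

end IsTail

end Nest

/-! ### The right ideal attached to a family with approximate null vectors -/

namespace Nest

variable {H : Type*} [NormedAddCommGroup H] [InnerProductSpace ℂ H] [CompleteSpace H]

namespace IsSemiInvariant

variable {𝒩 : Nest H} {𝓔 : Set (H →L[ℂ] H)}

/-- Compression to `E` is multiplicative on the nest algebra, so `E (X Y)* ξ = E Y* E X* ξ`. This is
what makes `rightIdeal` stable under right multiplication. -/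
theorem norm_apply_adjoint_mul_le (h : 𝒩.IsSemiInvariant 𝓔) {E X Y : H →L[ℂ] H} (hE : E ∈ 𝓔)
    (hX : X ∈ 𝒩.algebra) (hY : Y ∈ 𝒩.algebra) {ξ : H} (hξ : E ξ = ξ) :
    ‖E ((X * Y).adjoint ξ)‖ ≤ ‖Y‖ * ‖E (X.adjoint ξ)‖ := by
  have hEp := h.isStarProjection E hE
  have hcomp : ∀ Z : H →L[ℂ] H, ∀ z, (E * Z * E).adjoint z = E (Z.adjoint (E z)) := by
    intro Z z
    have h1 : star E = E := hEp.isSelfAdjoint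
    have h2 : (E * Z * E).adjoint = E * (star Z * E) := by
      change star (E * Z * E) = _
      rw [star_mul, star_mul, h1]
    rw [h2]
    rfl
  have e : E ((X * Y).adjoint ξ) = E (Y.adjoint (E (X.adjoint ξ))) := by
    calc E ((X * Y).adjoint ξ) = (E * (X * Y) * E).adjoint ξ := by rw [hcomp, hξ]
      _ = (E * Y * E).adjoint ((E * X * E).adjoint ξ) := by
          rw [h.compress_mul E hE X hX Y hY]
          simp only [ContinuousLinearMap.mul_def, ContinuousLinearMap.adjoint_comp,
            ContinuousLinearMap.comp_apply]
      _ = _ := by rw [hcomp, hcomp, hξ, hEp.apply_apply]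
  rw [e]
  refine (hEp.norm_apply_le _).trans ((Y.adjoint.le_opNorm _).trans_eq ?_)
  rw [LinearIsometryEquiv.norm_map]

/-- The right ideal of the operators whose adjoints are small, in the tail, on the common
approximate null vectors in the tail of the adjoints of the operators in `D`. -/
def rightIdeal (h : 𝒩.IsSemiInvariant 𝓔) (D : Set (H →L[ℂ] H)) :
    Submodule (𝒩.algebra)ᵐᵒᵖ 𝒩.algebra where
  carrier := {X | ∀ ε > 0, ∃ S : Finset (H →L[ℂ] H), ↑S ⊆ D ∧ ∃ δ > 0, ∃ E ∈ 𝓔, ∀ ξ : H,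
    ‖ξ‖ = 1 → E ξ = ξ → (∀ d ∈ S, ‖d.adjoint ξ‖ < δ) →
      ‖E ((X : H →L[ℂ] H).adjoint ξ)‖ < ε}
  zero_mem' := by
    intro ε hε
    obtain ⟨E, hE⟩ := h.nonempty
    exact ⟨∅, by simp, 1, one_pos, E, hE, fun ξ _ _ _ => by simpa using hε⟩
  add_mem' := by
    classical
    intro X Y hX hY ε hε
    obtain ⟨S, hS, δ, hδ, E, hE, hXE⟩ := hX (ε / 2) (half_pos hε)
    obtain ⟨S', hS', δ', hδ', E', hE', hYE⟩ := hY (ε / 2) (half_pos hε)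
    obtain ⟨F, hF, hFE, hFE'⟩ :=
      h.exists_of_eventually ((h.eventually_le hE).and (h.eventually_le hE'))
    have hFp := h.isStarProjection F hF
    refine ⟨S ∪ S', by simp [hS, hS'], min δ δ', lt_min hδ hδ', F, hF, fun ξ h1 hFξ h3 => ?_⟩
    have hEξ : E ξ = ξ := by
      rw [← hFξ, hFp.apply_apply_of_ge (h.isStarProjection E hE) hFE]
    have hEξ' : E' ξ = ξ := by
      rw [← hFξ, hFp.apply_apply_of_ge (h.isStarProjection E' hE') hFE']
    have hX' := (h.norm_apply_le_of_le hE hF hFE _).trans_lt (hXE ξ h1 hEξ fun d hd =>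
      (h3 d (Finset.mem_union_left _ hd)).trans_le (min_le_left _ _))
    have hY' := (h.norm_apply_le_of_le hE' hF hFE' _).trans_lt (hYE ξ h1 hEξ' fun d hd =>
      (h3 d (Finset.mem_union_right _ hd)).trans_le (min_le_right _ _))
    have e : F (((X + Y : 𝒩.algebra) : H →L[ℂ] H).adjoint ξ) =
        F ((X : H →L[ℂ] H).adjoint ξ) + F ((Y : H →L[ℂ] H).adjoint ξ) := by
      rw [← map_add]
      simp
    rw [e]
    exact (norm_add_le _ _).trans_lt (by linarith)
  smul_mem' := by
    intro Y X hX ε hε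
    set Z : 𝒩.algebra := Y.unop
    obtain ⟨S, hS, δ, hδ, E, hE, hXE⟩ := hX (ε / (‖(Z : H →L[ℂ] H)‖ + 1)) (by positivity)
    refine ⟨S, hS, δ, hδ, E, hE, fun ξ h1 hEξ h3 => ?_⟩
    have h4 := hXE ξ h1 hEξ h3
    rw [lt_div_iff₀ (by positivity)] at h4
    refine (h.norm_apply_adjoint_mul_le hE X.2 Z.2 hEξ).trans_lt ?_
    nlinarith [norm_nonneg (E ((X : H →L[ℂ] H).adjoint ξ))]

/-- The right ideal contains `J` with no condition on `ξ` beyond `E ξ = ξ`, contains each `d ∈ D ∩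
A` through the test set `{d}`, and omits `1` because `D` has approximate null vectors. -/
theorem isRightPrimitive (h : 𝒩.IsSemiInvariant 𝓔) {D : Set (H →L[ℂ] H)} (hD : ApproxNull 𝓔 D)
    (hXD : ∀ X ∈ 𝒩.algebra, (∃ δ > 0, ∀ E ∈ 𝓔, δ ≤ ‖E * X * E‖) →
      ∃ B ∈ 𝒩.algebra, ∃ C ∈ 𝒩.algebra, 1 - B * X * C ∈ D)
    (J : TwoSidedIdeal 𝒩.algebra)
    (hJ : ∀ X : 𝒩.algebra, X ∈ J ↔ ∀ ε > 0, ∃ E ∈ 𝓔, ‖E * (X : H →L[ℂ] H) * E‖ < ε) :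
    IsRightPrimitive J := by
  refine IsRightPrimitive.of_rightIdeal J (h.rightIdeal D) ?_ ?_ ?_
  · intro X hX ε hε
    obtain ⟨E, hE, hlt⟩ := (hJ X).1 hX ε hε
    refine ⟨∅, by simp, 1, one_pos, E, hE, fun ξ h1 hEξ _ => ?_⟩
    have h1' : star E = E := (h.isStarProjection E hE).isSelfAdjoint
    have h2 : (E * (X : H →L[ℂ] H) * E).adjoint = E * (star (X : H →L[ℂ] H) * E) := by
      change star (E * (X : H →L[ℂ] H) * E) = _
      rw [star_mul, star_mul, h1']
    have e : E ((X : H →L[ℂ] H).adjoint ξ) = (E * (X : H →L[ℂ] H) * E).adjoint ξ := by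
      conv_lhs => rw [← hEξ]
      rw [h2]
      rfl
    rw [e]
    refine ((ContinuousLinearMap.le_opNorm _ _).trans_eq ?_).trans_lt hlt
    rw [h1, mul_one, LinearIsometryEquiv.norm_map]
  · intro h1
    obtain ⟨S, hS, δ, hδ, E, hE, hlt⟩ := h1 1 one_pos
    obtain ⟨ξ, hξ, hEξ, hd⟩ := hD S hS δ hδ E hE
    have := hlt ξ hξ hEξ hd
    have h1 : ((1 : 𝒩.algebra) : H →L[ℂ] H).adjoint = 1 := star_one (H →L[ℂ] H)
    rw [h1, one_apply_eq_self, hEξ, hξ] at this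
    exact this.false
  · intro X hX
    rw [hJ] at hX
    push Not at hX
    obtain ⟨B, hB, C, hC, hBC⟩ := hXD X X.2 hX
    refine ⟨⟨B, hB⟩, ⟨C, hC⟩, fun ε hε => ?_⟩
    obtain ⟨E, hE⟩ := h.nonempty
    refine ⟨{1 - B * X * C}, by simpa using hBC, ε, hε, E, hE, fun ξ _ _ hξ => ?_⟩
    exact ((h.isStarProjection E hE).norm_apply_le _).trans_lt (hξ _ (Finset.mem_singleton_self _))

end IsSemiInvariant

/-! ### Transfinite iteration -/

namespace IsTail

variable {𝒩 : Nest H} {𝓔 : Set (H →L[ℂ] H)}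

/-- The condition concerns finite subfamilies only, and a finite set of indices lies below its
maximum. This carries the recursion through limit stages. -/
theorem approxNull_image (h : 𝒩.IsTail 𝓔) {ι : Type*} [LinearOrder ι] {d : ι → H →L[ℂ] H}
    {I : Set ι} (hd : ∀ j ∈ I, ApproxNull 𝓔 (d '' Set.Iic j)) : ApproxNull 𝓔 (d '' I) := by
  classical
  intro S hS ε hε E hE
  obtain ⟨T, hT, rfl⟩ := Finset.subset_set_image_iff.1 hS
  rcases T.eq_empty_or_nonempty with rfl | hne
  · obtain ⟨ξ, h1, h2⟩ := h.exists_unit hE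
    exact ⟨ξ, h1, h2, by simp⟩
  · refine hd (T.max' hne) (hT (T.max'_mem hne)) _ ?_ ε hε E hE
    rw [Finset.coe_image]
    exact Set.image_mono fun j hj => T.le_max' j hj

/-- Transfinite iteration of a one-step extension of countable families of operators whose adjoints
have common approximate null vectors. -/
theorem exists_approxNull_range (h : 𝒩.IsTail 𝓔) {ι : Type*} [LinearOrder ι] [WellFoundedLT ι]
    (hι : ∀ i : ι, (Set.Iio i).Countable) {Q : ι → (H →L[ℂ] H) → Prop}
    (step : ∀ (D : Set (H →L[ℂ] H)) (i : ι), D.Countable → ApproxNull 𝓔 D →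
      ∃ c, Q i c ∧ ApproxNull 𝓔 (insert c D)) :
    ∃ d : ι → H →L[ℂ] H, ApproxNull 𝓔 (Set.range d) ∧ ∀ i, Q i (d i) := by
  choose! c hcQ hc using step
  -- Each `d i` is obtained by applying the one-step extension to all earlier values.
  let d : ι → H →L[ℂ] H := (wellFounded_lt (α := ι)).fix fun i rec =>
    c {y | ∃ (j : ι) (hj : j < i), rec j hj = y} i
  have hd : ∀ i, d i = c (d '' Set.Iio i) i := by
    intro i
    have := (wellFounded_lt (α := ι)).fix_eq (fun i rec =>
      c {y | ∃ (j : ι) (hj : j < i), rec j hj = y} i) i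
    refine this.trans (congrArg (fun s => c s i) ?_)
    ext y
    simp [d]
  have key : ∀ i, ApproxNull 𝓔 (d '' Set.Iic i) := by
    intro i
    induction i using WellFoundedLT.induction with
    | ind i ih =>
      rw [← Set.Iio_insert, Set.image_insert_eq, hd i]
      exact hc _ i ((hι i).image d) (h.approxNull_image ih)
  refine ⟨d, ?_, fun i => ?_⟩
  · rw [← Set.image_univ]
    exact h.approxNull_image fun j _ => key j
  · rw [hd]
    exact hcQ _ i ((hι i).image d) (h.approxNull_image fun j _ => key j)

/-- Under the Continuum Hypothesis a transfinite iteration of `exists_approxNull_insert` takes care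
of all operators at once. -/
theorem exists_approxNull [TopologicalSpace.SeparableSpace H] (h : 𝒩.IsTail 𝓔)
    (hCH : (𝔠 : Cardinal.{0}) = ℵ₁) :
    ∃ D : Set (H →L[ℂ] H), ApproxNull 𝓔 D ∧
      ∀ X : H →L[ℂ] H, (∃ δ > 0, ∀ E ∈ 𝓔, δ ≤ ‖E * X * E‖) →
        ∃ B ∈ 𝒩.algebra, ∃ C ∈ 𝒩.algebra, 1 - B * X * C ∈ D := by
  let ι := {X : H →L[ℂ] H // ∃ δ > 0, ∀ E ∈ 𝓔, δ ≤ ‖E * X * E‖}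
  have hι : #ι ≤ ℵ₁ := by
    have h1 : #ι ≤ 𝔠 := (Cardinal.mk_subtype_le _).trans ContinuousLinearMap.mk_le_continuum
    -- The hypothesis lives in universe `0` and is lifted to the universe of `H`.
    have h2 := congrArg Cardinal.lift hCH
    rw [Cardinal.lift_continuum, Cardinal.lift_aleph, Ordinal.lift_one] at h2
    exact h2 ▸ h1
  obtain ⟨hl, hw, hcount⟩ := Cardinal.exists_wellOrder_countable_Iio hι
  obtain ⟨d, hd, hdQ⟩ := exists_approxNull_range h hcount
    (Q := fun X c => ∃ B ∈ 𝒩.algebra, ∃ C ∈ 𝒩.algebra, 1 - B * X.1 * C = c) (by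
      rintro D ⟨X, δ, hδ, hX⟩ hDc hD
      obtain ⟨B, hB, C, hC, hBC⟩ := h.exists_approxNull_insert hDc hD hδ hX
      exact ⟨_, ⟨B, hB, C, hC, rfl⟩, hBC⟩)
  refine ⟨Set.range d, hd, fun X hX => ?_⟩
  obtain ⟨B, hB, C, hC, e⟩ := hdQ ⟨X, hX⟩
  exact ⟨B, hB, C, hC, ⟨X, hX⟩, e.symm⟩

end IsTail

end Nest

/-! ### Strong limits in the nest: an immediate neighbour or a tail -/

section Limits

variable {H : Type*} [NormedAddCommGroup H] [InnerProductSpace ℂ H] [CompleteSpace H]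

/-- A monotone family of projections converges strongly. -/
theorem IsStarProjection.exists_tendsto_of_monotone {ι : Type*} [Preorder ι] {p : ι → H →L[ℂ] H}
    (hp : ∀ i, IsStarProjection (p i)) (hmono : Monotone p) :
    ∃ Q : H →L[ℂ] H, ∀ x, Tendsto (fun i => p i x) atTop (𝓝 (Q x)) := by
  choose U hU hpU using fun i => isStarProjection_iff_eq_starProjection.1 (hp i)
  have hUm : Monotone U := fun i j hij => by
    rw [← Submodule.starProjection_le_starProjection_iff, ← hpU, ← hpU]
    exact hmono hij
  refine ⟨(⨆ i, U i).topologicalClosure.starProjection, fun x => ?_⟩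
  simp only [hpU]
  exact Submodule.starProjection_tendsto_closure_iSup U hUm x

/-- An antitone family of projections converges strongly. -/
theorem IsStarProjection.exists_tendsto_of_antitone {ι : Type*} [Preorder ι] {p : ι → H →L[ℂ] H}
    (hp : ∀ i, IsStarProjection (p i)) (hanti : Antitone p) :
    ∃ Q : H →L[ℂ] H, ∀ x, Tendsto (fun i => p i x) atTop (𝓝 (Q x)) := by
  obtain ⟨Q, hQ⟩ := IsStarProjection.exists_tendsto_of_monotone (fun i => (hp i).one_sub)
    fun i j hij => sub_le_sub_left (hanti hij) 1
  refine ⟨1 - Q, fun x => ?_⟩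
  have := (hQ x).const_sub x
  simpa using this

end Limits

namespace Nest

variable {H : Type*} [NormedAddCommGroup H] [InnerProductSpace ℂ H] [CompleteSpace H]

theorem mem_carrier_of_tendsto (𝒩 : Nest H) {ι : Type*} {l : Filter ι} [l.NeBot]
    {p : ι → H →L[ℂ] H} (hp : ∀ i, p i ∈ 𝒩.carrier) {Q : H →L[ℂ] H}
    (hQ : ∀ x, Tendsto (fun i => p i x) l (𝓝 (Q x))) : Q ∈ 𝒩.carrier := by
  have hlim : Tendsto (fun i => ContinuousLinearMapWOT.ofCLM (p i)) l
      (𝓝 (ContinuousLinearMapWOT.ofCLM Q)) := by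
    rw [ContinuousLinearMapWOT.tendsto_iff_forall_inner_apply_tendsto]
    exact fun x y => (tendsto_const_nhds (x := y)).inner (hQ x)
  exact 𝒩.weakly_closed.mem_of_tendsto hlim (Eventually.of_forall hp)

/-- Either `N` has an immediate successor in the nest, or it is the strong limit of the larger
members of the nest. -/
theorem exists_succ_or_small (𝒩 : Nest H) {N : H →L[ℂ] H} (hN : N ∈ 𝒩.carrier) (hN1 : N < 1) :
    (∃ Q ∈ 𝒩.carrier, N < Q ∧ ∀ M ∈ 𝒩.carrier, N < M → Q ≤ M) ∨
      ∀ (x : H) (ε : ℝ), 0 < ε → ∃ M ∈ 𝒩.carrier, N < M ∧ ‖(M - N) x‖ < ε := by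
  -- The order is reversed so that `atTop` means decreasing to `N`. The strong limit `Q` belongs to
  -- the nest: it is the successor if `Q > N`, and if `Q = N` the intervals shrink to `0`.
  let S := {M : H →L[ℂ] H // M ∈ 𝒩.carrier ∧ N < M}ᵒᵈ
  let p : S → H →L[ℂ] H := fun M => (OrderDual.ofDual M).1
  have hpc : ∀ M : S, p M ∈ 𝒩.carrier := fun M => (OrderDual.ofDual M).2.1
  have hp := fun M : S => 𝒩.isStarProjection _ (hpc M)
  have hanti : Antitone p := fun _ _ h => h
  have : Nonempty S := ⟨OrderDual.toDual ⟨1, 𝒩.one_mem, hN1⟩⟩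
  have : IsDirectedOrder S := ⟨fun M M' => by
    rcases 𝒩.total _ (hpc M) _ (hpc M') with h | h
    · exact ⟨M, le_rfl, h⟩
    · exact ⟨M', h, le_rfl⟩⟩
  obtain ⟨Q, hQ⟩ := IsStarProjection.exists_tendsto_of_antitone hp hanti
  have hQc := 𝒩.mem_carrier_of_tendsto hpc hQ
  have hQp := 𝒩.isStarProjection Q hQc
  have hNp := 𝒩.isStarProjection N hN
  have hNQ : N ≤ Q := by
    refine (hNp.le_iff_mul_eq_left hQp).2 (ContinuousLinearMap.ext fun x => ?_)
    refine tendsto_nhds_unique ((N.continuous.tendsto _).comp (hQ x)) ?_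
    refine tendsto_const_nhds.congr fun M => ?_
    exact (hNp.apply_apply_of_le (hp M) (OrderDual.ofDual M).2.2.le x).symm
  rcases hNQ.lt_or_eq with hlt | rfl
  · refine Or.inl ⟨Q, hQc, hlt, fun M hM hNM => ?_⟩
    refine (hQp.le_iff_mul_eq_right (𝒩.isStarProjection M hM)).2
      (ContinuousLinearMap.ext fun x => ?_)
    refine tendsto_nhds_unique ((M.continuous.tendsto _).comp (hQ x)) ?_
    refine (hQ x).congr' ?_
    filter_upwards [eventually_ge_atTop (OrderDual.toDual ⟨M, hM, hNM⟩ : S)] with M' hM'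
    exact ((hp M').apply_apply_of_ge (𝒩.isStarProjection M hM) hM' x).symm
  · refine Or.inr fun x ε hε => ?_
    obtain ⟨M, hM⟩ := ((Metric.tendsto_nhds.1 (hQ x)) ε hε).exists
    refine ⟨p M, hpc M, (OrderDual.ofDual M).2.2, ?_⟩
    rwa [dist_eq_norm] at hM

/-- Either `N` has an immediate predecessor in the nest, or it is the strong limit of the smaller
members of the nest. -/
theorem exists_pred_or_small (𝒩 : Nest H) {N : H →L[ℂ] H} (hN : N ∈ 𝒩.carrier) (hN0 : 0 < N) :
    (∃ Q ∈ 𝒩.carrier, Q < N ∧ ∀ M ∈ 𝒩.carrier, M < N → M ≤ Q) ∨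
      ∀ (x : H) (ε : ℝ), 0 < ε → ∃ M ∈ 𝒩.carrier, M < N ∧ ‖(N - M) x‖ < ε := by
  let S := {M : H →L[ℂ] H // M ∈ 𝒩.carrier ∧ M < N}
  have hp := fun M : S => 𝒩.isStarProjection M.1 M.2.1
  have : Nonempty S := ⟨⟨0, 𝒩.zero_mem, hN0⟩⟩
  have : IsDirectedOrder S := ⟨fun M M' => by
    rcases 𝒩.total _ M.2.1 _ M'.2.1 with h | h
    · exact ⟨M', h, le_rfl⟩
    · exact ⟨M, le_rfl, h⟩⟩
  obtain ⟨Q, hQ⟩ := IsStarProjection.exists_tendsto_of_monotone hp fun _ _ h => h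
  have hQc := 𝒩.mem_carrier_of_tendsto (fun M : S => M.2.1) hQ
  have hQp := 𝒩.isStarProjection Q hQc
  have hNp := 𝒩.isStarProjection N hN
  have hQN : Q ≤ N := by
    refine (hQp.le_iff_mul_eq_right hNp).2 (ContinuousLinearMap.ext fun x => ?_)
    refine tendsto_nhds_unique ((N.continuous.tendsto _).comp (hQ x)) ?_
    exact (hQ x).congr fun M => ((hp M).apply_apply_of_ge hNp M.2.2.le x).symm
  rcases hQN.lt_or_eq with hlt | rfl
  · refine Or.inl ⟨Q, hQc, hlt, fun M hM hMN => ?_⟩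
    have hMp := 𝒩.isStarProjection M hM
    refine (hMp.le_iff_mul_eq_left hQp).2 (ContinuousLinearMap.ext fun x => ?_)
    refine tendsto_nhds_unique ((M.continuous.tendsto _).comp (hQ x)) ?_
    refine tendsto_const_nhds.congr' ?_
    filter_upwards [eventually_ge_atTop (⟨M, hM, hMN⟩ : S)] with M' hM'
    exact (hMp.apply_apply_of_le (hp M') hM' x).symm
  · refine Or.inr fun x ε hε => ?_
    obtain ⟨M, hM⟩ := ((Metric.tendsto_nhds.1 (hQ x)) ε hε).exists
    refine ⟨M, M.2.1, M.2.2, ?_⟩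
    rwa [dist_comm, dist_eq_norm] at hM

/-! ### Rank one operators, atoms, and the tails at `N` -/

theorem rankOne_mem_algebra (𝒩 : Nest H) {u v : H}
    (h : ∀ P ∈ 𝒩.carrier, P u = u ∨ P v = 0) : InnerProductSpace.rankOne ℂ u v ∈ 𝒩.algebra := by
  rw [mem_algebra_iff]
  intro P hP z hz
  rw [InnerProductSpace.rankOne_apply, map_smul]
  rcases h P hP with hu | hv
  · rw [hu]
  · rw [← hz, ← (𝒩.isStarProjection P hP).inner_apply_left, hv, inner_zero_left, zero_smul,
      zero_smul]

theorem rankOne_mem_algebra_of_mem (𝒩 : Nest H) {M : H →L[ℂ] H} (hM : M ∈ 𝒩.carrier) {u v : H}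
    (hu : M u = u) (hv : M v = 0) : InnerProductSpace.rankOne ℂ u v ∈ 𝒩.algebra := by
  refine 𝒩.rankOne_mem_algebra fun P hP => ?_
  have hPp := 𝒩.isStarProjection P hP
  have hMp := 𝒩.isStarProjection M hM
  rcases 𝒩.total P hP M hM with hle | hle
  · exact Or.inr (by rw [← hPp.apply_apply_of_le hMp hle, hv, map_zero])
  · exact Or.inl (by rw [← hu, hMp.apply_apply_of_ge hPp hle])

/-- The compression to an atom of a nest has a right-primitive kernel. -/
theorem isRightPrimitive_of_atom (𝒩 : Nest H) {P Q : H →L[ℂ] H} (hP : P ∈ 𝒩.carrier)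
    (hQ : Q ∈ 𝒩.carrier) (hPQ : P < Q) (hatom : ∀ M ∈ 𝒩.carrier, M ≤ P ∨ Q ≤ M)
    (J : TwoSidedIdeal 𝒩.algebra)
    (hJ : ∀ X : 𝒩.algebra, X ∈ J ↔ ∀ ε > 0, ‖(Q - P) * (X : H →L[ℂ] H) * (Q - P)‖ < ε) :
    IsRightPrimitive J := by
  have hPp := 𝒩.isStarProjection P hP
  have hQp := 𝒩.isStarProjection Q hQ
  have hE : IsStarProjection (Q - P) := (hPp.le_iff_sub hQp).1 hPQ.le
  have h : 𝒩.IsSemiInvariant {Q - P} :=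
    { nonempty := Set.singleton_nonempty _
      isStarProjection := by
        rintro _ rfl
        exact hE
      ne_zero := by
        rintro _ rfl
        exact sub_ne_zero.2 hPQ.ne'
      total := by
        rintro _ rfl _ rfl
        exact Or.inl le_rfl
      compress_mul := by
        rintro _ rfl X hX Y hY
        exact 𝒩.compress_mul hP hQ hPQ.le hX hY }
  obtain ⟨e, he, hEe⟩ := h.exists_unit rfl
  have hrank : ∀ u v : H, (Q - P) u = u → (Q - P) v = v →
      InnerProductSpace.rankOne ℂ u v ∈ 𝒩.algebra := by
    intro u v hu hv
    refine 𝒩.rankOne_mem_algebra fun M hM => ?_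
    have hMp := 𝒩.isStarProjection M hM
    rcases hatom M hM with hle | hle
    · refine Or.inr ?_
      rw [← hv, sub_apply, map_sub, hMp.apply_apply_of_le hQp (hle.trans hPQ.le),
        hMp.apply_apply_of_le hPp hle, sub_self]
    · refine Or.inl ?_
      rw [← hu, sub_apply, map_sub, hQp.apply_apply_of_ge hMp hle,
        hPp.apply_apply_of_ge hMp (hPQ.le.trans hle)]
  -- The single vector `e` is an exact common null vector, so no transfinite construction is needed
  -- here.
  refine h.isRightPrimitive (D := {d | d.adjoint e = 0}) ?_ ?_ J (by simpa using hJ)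
  · rintro S hS ε hε _ rfl
    refine ⟨e, he, hEe, fun d hd => ?_⟩
    rw [show d.adjoint e = 0 from hS hd, norm_zero]
    exact hε
  · rintro X hX ⟨δ, hδ, hle⟩
    obtain ⟨x, hx⟩ : ∃ x, ((Q - P) * X * (Q - P)) x ≠ 0 := by
      by_contra! h0
      have := hle _ rfl
      rw [show (Q - P) * X * (Q - P) = 0 from ContinuousLinearMap.ext h0, norm_zero] at this
      linarith
    set y := (Q - P) (X ((Q - P) x)) with hy
    have hy0 : y ≠ 0 := hx
    have hEy : (Q - P) y = y := hE.apply_apply _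
    have hyy : ⟪y, X ((Q - P) x)⟫_ℂ = (‖y‖ : ℂ) ^ 2 := by
      refine Eq.trans ?_ (inner_self_eq_norm_sq_to_K (𝕜 := ℂ) y)
      calc ⟪y, X ((Q - P) x)⟫_ℂ = ⟪(Q - P) y, X ((Q - P) x)⟫_ℂ := by rw [hEy]
        _ = ⟪y, y⟫_ℂ := hE.inner_apply_left _ _
    have hn : (‖y‖ : ℂ) ≠ 0 := by simpa using hy0
    -- With `y = E X E x`, `B = ‖y‖⁻² e ⊗ y*` and `C = E x ⊗ e*`, the product `B X C` is the
    -- projection onto the line of `e`.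
    refine ⟨_, 𝒩.algebra.smul_mem (hrank e y hEe hEy) ((‖y‖ : ℂ) ^ 2)⁻¹, _,
      hrank ((Q - P) x) e (hE.apply_apply x) hEe, ?_⟩
    have e1 : ((((‖y‖ : ℂ) ^ 2)⁻¹ • InnerProductSpace.rankOne ℂ e y) * X *
        InnerProductSpace.rankOne ℂ ((Q - P) x) e : H →L[ℂ] H) =
        InnerProductSpace.rankOne ℂ e e := by
      refine ContinuousLinearMap.ext fun z => ?_
      simp only [mul_apply_eq_comp, smul_apply,
        InnerProductSpace.rankOne_apply, map_smul, hyy, smul_smul]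
      congr 1
      field_simp
    change (1 - _ : H →L[ℂ] H).adjoint e = 0
    rw [e1, map_sub, sub_apply, InnerProductSpace.adjoint_rankOne,
      InnerProductSpace.rankOne_apply, inner_self_eq_norm_sq_to_K, he,
      show (1 : H →L[ℂ] H).adjoint = 1 from star_one (H →L[ℂ] H)]
    simp

theorem isTail_plus (𝒩 : Nest H) {N : H →L[ℂ] H} (hN : N ∈ 𝒩.carrier) (hN1 : N < 1)
    (hs : ∀ (x : H) (ε : ℝ), 0 < ε → ∃ M ∈ 𝒩.carrier, N < M ∧ ‖(M - N) x‖ < ε) :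
    𝒩.IsTail ((· - N) '' {M | M ∈ 𝒩.carrier ∧ N < M}) where
  nonempty := ⟨_, 1, ⟨𝒩.one_mem, hN1⟩, rfl⟩
  isStarProjection := by
    rintro _ ⟨M, ⟨hM, hNM⟩, rfl⟩
    exact ((𝒩.isStarProjection N hN).le_iff_sub (𝒩.isStarProjection M hM)).1 hNM.le
  ne_zero := by
    rintro _ ⟨M, ⟨hM, hNM⟩, rfl⟩
    exact sub_ne_zero.2 hNM.ne'
  total := by
    rintro _ ⟨M, ⟨hM, hNM⟩, rfl⟩ _ ⟨M', ⟨hM', hNM'⟩, rfl⟩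
    exact (𝒩.total M hM M' hM').imp (fun h => sub_le_sub_right h N) fun h => sub_le_sub_right h N
  compress_mul := by
    rintro _ ⟨M, ⟨hM, hNM⟩, rfl⟩ X hX Y hY
    exact 𝒩.compress_mul hN hM hNM.le hX hY
  exists_norm_lt := by
    intro x ε hε
    obtain ⟨M, hM, hNM, h⟩ := hs x ε hε
    exact ⟨_, ⟨M, ⟨hM, hNM⟩, rfl⟩, h⟩
  rankOne_mem := by
    -- The member `M'` of the nest fixes `u` and kills `v`: allowed moves go down towards `N`, that
    -- is, deeper into the tail.
    left
    rintro _ ⟨M, ⟨hM, hNM⟩, rfl⟩ _ ⟨M', ⟨hM', hNM'⟩, rfl⟩ hle u v hu hv hv'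
    have hNp := 𝒩.isStarProjection N hN
    have hMp := 𝒩.isStarProjection M hM
    have hMp' := 𝒩.isStarProjection M' hM'
    refine 𝒩.rankOne_mem_algebra_of_mem hM' ?_ ?_
    · rw [← hu]
      simp only [sub_apply, map_sub, hMp'.apply_apply, hNp.apply_apply_of_ge hMp' hNM'.le]
    · have hNv : N v = 0 := by
        rw [← hv]
        simp only [sub_apply, map_sub, hNp.apply_apply, hNp.apply_apply_of_le hMp hNM.le, sub_self]
      simpa only [sub_apply, hNv, sub_zero] using hv'

theorem isTail_minus (𝒩 : Nest H) {N : H →L[ℂ] H} (hN : N ∈ 𝒩.carrier) (hN0 : 0 < N)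
    (hs : ∀ (x : H) (ε : ℝ), 0 < ε → ∃ M ∈ 𝒩.carrier, M < N ∧ ‖(N - M) x‖ < ε) :
    𝒩.IsTail ((N - ·) '' {M | M ∈ 𝒩.carrier ∧ M < N}) where
  nonempty := ⟨_, 0, ⟨𝒩.zero_mem, hN0⟩, rfl⟩
  isStarProjection := by
    rintro _ ⟨M, ⟨hM, hMN⟩, rfl⟩
    exact ((𝒩.isStarProjection M hM).le_iff_sub (𝒩.isStarProjection N hN)).1 hMN.le
  ne_zero := by
    rintro _ ⟨M, ⟨hM, hMN⟩, rfl⟩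
    exact sub_ne_zero.2 hMN.ne'
  total := by
    rintro _ ⟨M, ⟨hM, hMN⟩, rfl⟩ _ ⟨M', ⟨hM', hMN'⟩, rfl⟩
    exact (𝒩.total M' hM' M hM).imp (fun h => sub_le_sub_left h N) fun h => sub_le_sub_left h N
  compress_mul := by
    rintro _ ⟨M, ⟨hM, hMN⟩, rfl⟩ X hX Y hY
    exact 𝒩.compress_mul hM hN hMN.le hX hY
  exists_norm_lt := by
    intro x ε hε
    obtain ⟨M, hM, hMN, h⟩ := hs x ε hε
    exact ⟨_, ⟨M, ⟨hM, hMN⟩, rfl⟩, h⟩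
  rankOne_mem := by
    -- Here deeper tail members are `N - M` with `M` closer to `N`, so allowed moves lead out of the
    -- tail; again `M'` fixes `u` and kills `v`.
    right
    rintro _ ⟨M, ⟨hM, hMN⟩, rfl⟩ _ ⟨M', ⟨hM', hMN'⟩, rfl⟩ hle u v hu hu' hv
    have hNp := 𝒩.isStarProjection N hN
    have hMp := 𝒩.isStarProjection M hM
    have hMp' := 𝒩.isStarProjection M' hM'
    refine 𝒩.rankOne_mem_algebra_of_mem hM' ?_ ?_
    · have hNu : N u = u := by
        rw [← hu]
        simp only [sub_apply, map_sub, hNp.apply_apply, hMp.apply_apply_of_ge hNp hMN.le]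
      rw [sub_apply, hNu, sub_eq_zero] at hu'
      exact hu'.symm
    · rw [← hv]
      simp only [sub_apply, map_sub, hMp'.apply_apply, hMp'.apply_apply_of_le hNp hMN'.le, sub_self]

/-! ### Conclusion for the two kinds of diagonal ideals -/

theorem mem_idealPlus_iff (𝒩 : Nest H) {N : H →L[ℂ] H} (hN : N ∈ 𝒩.carrier) (hN1 : N < 1)
    (X : 𝒩.algebra) : X ∈ 𝒩.idealPlus N hN hN1 ↔
      ∀ ε > 0, ∃ M ∈ 𝒩.carrier, N < M ∧ ‖(M - N) * (X : H →L[ℂ] H) * (M - N)‖ < ε := by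
  rw [idealPlus, TwoSidedIdeal.mem_mk']
  exact 𝒩.iPlus_eq_zero_iff hN1 _

theorem mem_idealMinus_iff (𝒩 : Nest H) {N : H →L[ℂ] H} (hN : N ∈ 𝒩.carrier) (hN0 : 0 < N)
    (X : 𝒩.algebra) : X ∈ 𝒩.idealMinus N hN hN0 ↔
      ∀ ε > 0, ∃ M ∈ 𝒩.carrier, M < N ∧ ‖(N - M) * (X : H →L[ℂ] H) * (N - M)‖ < ε := by
  rw [idealMinus, TwoSidedIdeal.mem_mk']
  exact 𝒩.iMinus_eq_zero_iff hN0 _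

theorem not_lt_iff_le (𝒩 : Nest H) {P Q : H →L[ℂ] H} (hP : P ∈ 𝒩.carrier) (hQ : Q ∈ 𝒩.carrier) :
    ¬P < Q ↔ Q ≤ P := by
  refine ⟨fun h => ?_, fun h => h.not_gt⟩
  rcases 𝒩.total P hP Q hQ with hle | hle
  · exact (eq_or_lt_of_le hle).elim (fun e => e.ge) fun hlt => (h hlt).elim
  · exact hle

theorem isRightPrimitive_idealPlus [TopologicalSpace.SeparableSpace H]
    (hCH : (𝔠 : Cardinal.{0}) = ℵ₁) (𝒩 : Nest H) {N : H →L[ℂ] H} (hN : N ∈ 𝒩.carrier)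
    (hN1 : N < 1) : IsRightPrimitive (𝒩.idealPlus N hN hN1) := by
  rcases 𝒩.exists_succ_or_small hN hN1 with ⟨Q, hQ, hNQ, hleast⟩ | hs
  · refine 𝒩.isRightPrimitive_of_atom hN hQ hNQ (fun M hM => ?_) _ fun X => ?_
    · by_cases hNM : N < M
      · exact Or.inr (hleast M hM hNM)
      · exact Or.inl ((𝒩.not_lt_iff_le hN hM).1 hNM)
    · rw [𝒩.mem_idealPlus_iff]
      refine forall₂_congr fun ε hε => ⟨?_, fun h => ⟨Q, hQ, hNQ, h⟩⟩
      rintro ⟨M, hM, hNM, h⟩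
      exact (𝒩.norm_compress_le hN hN hM hQ le_rfl hNQ.le (hleast M hM hNM) _).trans_lt h
  · have h := 𝒩.isTail_plus hN hN1 hs
    obtain ⟨D, hD, hXD⟩ := h.exists_approxNull hCH
    refine h.isRightPrimitive hD (fun X _ => hXD X) _ fun X => ?_
    rw [𝒩.mem_idealPlus_iff]
    simp [and_assoc]

theorem isRightPrimitive_idealMinus [TopologicalSpace.SeparableSpace H]
    (hCH : (𝔠 : Cardinal.{0}) = ℵ₁) (𝒩 : Nest H) {N : H →L[ℂ] H} (hN : N ∈ 𝒩.carrier)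
    (hN0 : 0 < N) : IsRightPrimitive (𝒩.idealMinus N hN hN0) := by
  rcases 𝒩.exists_pred_or_small hN hN0 with ⟨Q, hQ, hQN, hgreatest⟩ | hs
  · refine 𝒩.isRightPrimitive_of_atom hQ hN hQN (fun M hM => ?_) _ fun X => ?_
    · by_cases hMN : M < N
      · exact Or.inl (hgreatest M hM hMN)
      · exact Or.inr ((𝒩.not_lt_iff_le hM hN).1 hMN)
    · rw [𝒩.mem_idealMinus_iff]
      refine forall₂_congr fun ε hε => ⟨?_, fun h => ⟨Q, hQ, hQN, h⟩⟩
      rintro ⟨M, hM, hMN, h⟩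
      exact (𝒩.norm_compress_le hM hQ hN hN (hgreatest M hM hMN) hQN.le le_rfl _).trans_lt h
  · have h := 𝒩.isTail_minus hN hN0 hs
    obtain ⟨D, hD, hXD⟩ := h.exists_approxNull hCH
    refine h.isRightPrimitive hD (fun X _ => hXD X) _ fun X => ?_
    rw [𝒩.mem_idealMinus_iff]
    simp [and_assoc]

end Nest

theorem mainTheorem2 {H : Type*} [NormedAddCommGroup H] [InnerProductSpace ℂ H] [CompleteSpace H]
    [TopologicalSpace.SeparableSpace H]
    (continuum_hypothesis : (𝔠 : Cardinal.{0}) = ℵ₁)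
    (𝒩 : Nest H) (J : TwoSidedIdeal 𝒩.algebra) (hJ : 𝒩.IsDiagonalIdeal J) :
    IsRightPrimitive J := by
  rcases hJ with ⟨N, hN, hN1, rfl⟩ | ⟨N, hN, hN0, rfl⟩
  · exact Nest.isRightPrimitive_idealPlus continuum_hypothesis 𝒩 hN hN1
  · exact Nest.isRightPrimitive_idealMinus continuum_hypothesis 𝒩 hN hN0
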